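/- Let $\lambda,\mu,\xi,V>0$, $0<a\le 1$, $b=1-a$, and let $M_1\ge 0$, $M>M_1+1$ be integers. On a probability space let $t_1,t_2,\dots$ be the points (attack times) of a Poisson point process of rate $\lambda$ on $[0,\infty)$; let $n_1,n_2,\dots$ (nodes lost in each attack) be iid geometric, $P\{n_k=i\}=ab^{\,i-1}$ for $i\ge1$; let $w_{jk}$ (weight of the $j$-th node lost in the $k$-th attack) be iid exponential with parameter $\xi$; and let $\Delta_1,\Delta_2,\dots$ (inter-observation times) be iid exponential with parameter $\mu$; the four families are mutually independent. Put $\tau_0=0$, $\tau_m=\Delta_1+\dots+\Delta_m$, and let $$N_m=\sum_{k:\,t_k\in[0,\tau_m]}n_k,\qquad W_m=\sum_{k:\,t_k\in[0,\tau_m]}\ \sum_{j=1}^{n_k}w_{jk}$$ be the number of nodes and the weight lost up to the observation time $\tau_m$. Let $$\mu_1=\inf\{m\ge 0:N_m>M_1\},\quad \mu_*=\inf\{m\ge 0:N_m>M\},\quad \nu=\inf\{m\ge 0:W_m>V\},\quad \rho=\min\{\mu_*,\nu\}.$$ Define $$l(z)=\frac{\xi}{\xi+z},\quad c(\theta)=\frac{\lambda+b\theta}{\lambda+\theta},\quad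 d(\theta)=\frac{\lambda+b(\mu+\theta)}{\lambda+\mu+\theta},\quad s(x,y)=\sum_{i=1}^{M-M_1-1}\Bigl(\frac{c(x)}{d(y)}\Bigr)^i,$$ $$P(k,z)=1-\frac{\Gamma(k,z)}{\Gamma(k)}\ (k\ge1),\quad P(0,z)=1,\qquad r_0^{k-1}(u,v,\theta)=e^{-(v+\xi)V}\sum_{i=0}^{k-1}\frac{(\xi d(\theta)uV)^i}{i!}$$ (an empty sum is $0$), where $\Gamma(k,z)$ is the upper incomplete gamma function, and for $k\ge0$ $$B_k=\frac{P(k,(\beta+\xi)V)}{(\beta+\xi)^{k}}-\frac{e^{-(\beta+\xi(1-d(h)\alpha))V}-r_0^{k-1}(\alpha,\beta,h)}{(d(h)\alpha\xi)^{k}}.$$ Then for all complex $\alpha,\beta,h$ with $0<|\alpha|\le1$, $\operatorname{Re}\beta\ge0$, $\operatorname{Re}h\ge0$ the random variable below is integrable and $$E\Bigl[\alpha^{N_\rho}e^{-\beta W_\rho}e^{-h\tau_\rho}\mathbf 1_{\{\mu_1<\rho\}}\Bigr] =\frac{(a\mu\lambda)^2\,\alpha^{M_1+2}\,\xi^{M_1+1}\,c(h)^{M_1}}{\bigl(1-d(h)\alpha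 l(\beta)\bigr)(h+\lambda)^2(\mu+h+\lambda)^2}\cdot\frac{1}{\beta+\xi(1-d(h)\alpha)}$$ $$\times\Bigl\{\,l(\beta)B_{M_1}+\Bigl(l(\beta)-\frac1{\alpha c(h)}\Bigr)\sum_{j=1}^{M-M_1-1}(c(h)\alpha\xi)^jB_{M_1+j} -(d(h)\alpha\xi)^{M-M_1}\Bigl[l(\beta)+\Bigl(l(\beta)-\frac1{\alpha c(h)}\Bigr)s(h,h)\Bigr]B_{M}\Bigr\}.$$ -/

import Mathlib

open MeasureTheory ProbabilityTheory Set

namespace NetworkAttack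

/-! ### The attack process and its delayed observation -/

section Model

variable {Ω : Type*}

/-- `#{k : t_k ∈ B}`, the number of attacks (strikes) in the time set `B`. -/
noncomputable def attackCount (t : ℕ → Ω → ℝ) (B : Set ℝ) (ω : Ω) : ℕ∞ :=
  {k : ℕ | t k ω ∈ B}.encard

/-- `𝒩(B) = ∑_k n_k 1{t_k ∈ B}`, the number of nodes lost during the time set `B`
(almost surely a finite sum when `B` is bounded). -/
noncomputable def nodeLoss (t : ℕ → Ω → ℝ) (n : ℕ → Ω → ℕ) (B : Set ℝ) (ω : Ω) : ℕ :=
  ∑' k : ℕ, {k : ℕ | t k ω ∈ B}.indicator (fun k => n k ω) k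

/-- `𝒲(B) = ∑_k w_k 1{t_k ∈ B}` with `w_k = w_{1k} + ⋯ + w_{n_k k}`, the weight lost during the
time set `B`.  Here `w k j` is the weight of the `(j+1)`-st node struck at time `t k`. -/
noncomputable def weightLoss (t : ℕ → Ω → ℝ) (n : ℕ → Ω → ℕ) (w : ℕ → ℕ → Ω → ℝ)
    (B : Set ℝ) (ω : Ω) : ℝ :=
  ∑' k : ℕ, {k : ℕ | t k ω ∈ B}.indicator (fun k => ∑ j ∈ Finset.range (n k ω), w k j ω) k

/-- The observation epochs: `τ_0 = 0` and `τ_m = Δ_1 + ⋯ + Δ_m`; the inter-observation time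
`Δ_{i+1} = τ_{i+1} - τ_i` is written `Δ i`. -/
noncomputable def obsTime (Δ : ℕ → Ω → ℝ) (m : ℕ) (ω : Ω) : ℝ :=
  ∑ i ∈ Finset.range m, Δ i ω

/-- The `m`-th observation window: `[0, τ_0]` for `m = 0`, and `(τ_{m-1}, τ_m]` for `m ≥ 1`. -/
noncomputable def obsWindow (Δ : ℕ → Ω → ℝ) (m : ℕ) (ω : Ω) : Set ℝ :=
  match m with
  | 0 => Icc 0 (obsTime Δ 0 ω)
  | m + 1 => Ioc (obsTime Δ m ω) (obsTime Δ (m + 1) ω)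

/-- `N_m = X_0 + ⋯ + X_m`, where `X_i` is the number of nodes lost in the `i`-th window. -/
noncomputable def cumNodes (t : ℕ → Ω → ℝ) (n : ℕ → Ω → ℕ) (Δ : ℕ → Ω → ℝ)
    (m : ℕ) (ω : Ω) : ℕ :=
  ∑ i ∈ Finset.range (m + 1), nodeLoss t n (obsWindow Δ i ω) ω

/-- `W_m = Y_0 + ⋯ + Y_m`, where `Y_i` is the weight lost in the `i`-th window. -/
noncomputable def cumWeight (t : ℕ → Ω → ℝ) (n : ℕ → Ω → ℕ) (w : ℕ → ℕ → Ω → ℝ)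
    (Δ : ℕ → Ω → ℝ) (m : ℕ) (ω : Ω) : ℝ :=
  ∑ i ∈ Finset.range (m + 1), weightLoss t n w (obsWindow Δ i ω) ω

/-- `inf {m ≥ 0 : N_m > p}` (with `inf ∅ = ∞`), the exit index of the node component at the
threshold `p`. It is `μ₁` for `p = M₁` and `μ` for `p = M`. -/
noncomputable def nodeExit (t : ℕ → Ω → ℝ) (n : ℕ → Ω → ℕ) (Δ : ℕ → Ω → ℝ)
    (p : ℕ) (ω : Ω) : ℕ∞ :=
  ⨅ m ∈ {m : ℕ | p < cumNodes t n Δ m ω}, (m : ℕ∞)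

/-- `ν = inf {m ≥ 0 : W_m > V}` (with `inf ∅ = ∞`), the exit index of the weight component. -/
noncomputable def weightExit (t : ℕ → Ω → ℝ) (n : ℕ → Ω → ℕ) (w : ℕ → ℕ → Ω → ℝ)
    (Δ : ℕ → Ω → ℝ) (V : ℝ) (ω : Ω) : ℕ∞ :=
  ⨅ m ∈ {m : ℕ | V < cumWeight t n w Δ m ω}, (m : ℕ∞)

/-- `ρ = min {μ, ν}`, the first observed passage index. -/
noncomputable def firstExit (t : ℕ → Ω → ℝ) (n : ℕ → Ω → ℕ) (w : ℕ → ℕ → Ω → ℝ)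
    (Δ : ℕ → Ω → ℝ) (M : ℕ) (V : ℝ) (ω : Ω) : ℕ∞ :=
  min (nodeExit t n Δ M ω) (weightExit t n w Δ V ω)

/-- The random variable `α^{N_ρ} e^{-β W_ρ} e^{-h τ_ρ} 1{μ₁ < ρ}`, where `ρ = min {μ, ν}`.
(Almost surely `ρ` is finite, so the value `toNat ⊤ = 0` plays no role.) -/
noncomputable def exitVariable (t : ℕ → Ω → ℝ) (n : ℕ → Ω → ℕ) (w : ℕ → ℕ → Ω → ℝ)
    (Δ : ℕ → Ω → ℝ) (M₁ M : ℕ) (V : ℝ) (α β h : ℂ) : Ω → ℂ :=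
  {ω | nodeExit t n Δ M₁ ω < firstExit t n w Δ M V ω}.indicator fun ω =>
    α ^ cumNodes t n Δ (firstExit t n w Δ M V ω).toNat ω
      * Complex.exp (-β * (cumWeight t n w Δ (firstExit t n w Δ M V ω).toNat ω : ℂ))
      * Complex.exp (-h * (obsTime Δ (firstExit t n w Δ M V ω).toNat ω : ℂ))

/-- `t` enumerates the points of a Poisson point process of rate `lam` on `[0, ∞)`: the number of
points in a Borel set `B` of finite Lebesgue measure is Poisson with mean `lam * |B|`, and the
numbers of points in pairwise disjoint such sets are independent. -/
structure IsPoissonProcess [MeasurableSpace Ω] (P : Measure Ω) (lam : ℝ) (t : ℕ → Ω → ℝ) :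
    Prop where
  measurable : ∀ k, Measurable (t k)
  law : ∀ B : Set ℝ, MeasurableSet B → B ⊆ Ici 0 → volume B ≠ ⊤ → ∀ j : ℕ,
    P {ω | attackCount t B ω = (j : ℕ∞)} =
      ENNReal.ofReal (Real.exp (-(lam * (volume B).toReal)) * (lam * (volume B).toReal) ^ j
        / (j.factorial : ℝ))
  indep : ∀ (r : ℕ) (B : Fin r → Set ℝ), (∀ i, MeasurableSet (B i)) → (∀ i, B i ⊆ Ici 0) →
    (∀ i, volume (B i) ≠ ⊤) → Pairwise (fun i j => Disjoint (B i) (B j)) →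
    iIndepFun (fun i ω => attackCount t (B i) ω) P

/-- The stochastic model with exponential observations:
* attack times `t k`: Poisson point process of rate `lam`;
* nodes lost per strike `n k`: iid geometric, `P{n k = i} = a (1-a)^{i-1}` for `i ≥ 1`;
* weights per node `w k j`: iid exponential with parameter `ξ`;
* inter-observation times `Δ i`: iid exponential with parameter `mu`;
* the four families are mutually independent.
The observations start at time `0` without initial damage; see `obsTime`. -/
structure IsExponentialModel [MeasurableSpace Ω] (P : Measure Ω) (lam mu a ξ : ℝ)
    (t : ℕ → Ω → ℝ) (n : ℕ → Ω → ℕ) (w : ℕ → ℕ → Ω → ℝ) (Δ : ℕ → Ω → ℝ) : Prop where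
  attacks : IsPoissonProcess P lam t
  measurable_nodes : ∀ k, Measurable (n k)
  nodes_law : ∀ k i : ℕ, P {ω | n k ω = i + 1} = ENNReal.ofReal (a * (1 - a) ^ i)
  nodes_indep : iIndepFun n P
  measurable_weight : ∀ k j, Measurable (w k j)
  weight_law : ∀ k j, P.map (w k j) = expMeasure ξ
  weight_indep : iIndepFun (fun (p : ℕ × ℕ) => w p.1 p.2) P
  measurable_obs : ∀ i, Measurable (Δ i)
  obs_law : ∀ i, P.map (Δ i) = expMeasure mu
  obs_indep : iIndepFun Δ P
  indep : iIndep (![⨆ k, MeasurableSpace.comap (t k) inferInstance,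
      ⨆ k, MeasurableSpace.comap (n k) inferInstance,
      ⨆ k, ⨆ j, MeasurableSpace.comap (w k j) inferInstance,
      ⨆ i, MeasurableSpace.comap (Δ i) inferInstance] : Fin 4 → MeasurableSpace Ω) P

end Model

/-! ### The closed form -/

/-- The upper incomplete gamma function `Γ(s, z) = ∫_z^∞ x^{s-1} e^{-x} dx`, for `Re z > 0`; the
integral is along the ray `x = z + r`, `r > 0`. -/
noncomputable def upperGamma (s z : ℂ) : ℂ :=
  ∫ r in Ioi (0 : ℝ), (z + r) ^ (s - 1) * Complex.exp (-(z + r))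

/-- The regularized incomplete gamma function `P(s, z) = 1 - Γ(s, z) / Γ(s)`.  At `s = 0` it is
`1`, the usual convention `1 / Γ(0) = 0`, since `Complex.Gamma 0 = 0` and division by `0` gives
`0`. -/
noncomputable def regGamma (s z : ℂ) : ℂ := 1 - upperGamma s z / Complex.Gamma s

/-- `l(z) = ξ / (ξ + z)`. -/
noncomputable def lFun (ξ : ℝ) (z : ℂ) : ℂ := ξ / (ξ + z)

/-- `c(θ) = (λ + bθ) / (λ + θ)`, where `b = 1 - a`. -/
noncomputable def cFun (lam a : ℝ) (θ : ℂ) : ℂ := (lam + (1 - a) * θ) / (lam + θ)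

/-- `d(θ) = (λ + b(μ + θ)) / (λ + μ + θ)`, where `b = 1 - a`. -/
noncomputable def dFun (lam mu a : ℝ) (θ : ℂ) : ℂ :=
  (lam + (1 - a) * (mu + θ)) / (lam + mu + θ)

/-- `r_0^{m-1}(u, v, θ) = e^{-(v+ξ)V} ∑_{i=0}^{m-1} (ξ d(θ) u V)^i / i!` (the sum has `m` terms and
is `0` for `m = 0`). -/
noncomputable def rFun (lam mu a ξ V : ℝ) (m : ℕ) (u v θ : ℂ) : ℂ :=
  Complex.exp (-(v + ξ) * V) *
    ∑ i ∈ Finset.range m, (ξ * dFun lam mu a θ * u * V) ^ i / (i.factorial : ℂ)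

/-- `s(x, y) = ∑_{i=1}^{M-M₁-1} (c(x) / d(y))^i`. -/
noncomputable def sFun (lam mu a : ℝ) (M₁ M : ℕ) (x y : ℂ) : ℂ :=
  ∑ i ∈ Finset.Icc 1 (M - M₁ - 1), (cFun lam a x / dFun lam mu a y) ^ i

/-- The bracket
`P(m, (β+ξ)V) / (β+ξ)^m - (e^{-(β+ξ(1-d(h)α))V} - r_0^{m-1}(α,β,h)) / (d(h)αξ)^m`. -/
noncomputable def bracket (lam mu a ξ V : ℝ) (m : ℕ) (α β h : ℂ) : ℂ :=
  regGamma m ((β + ξ) * V) / (β + ξ) ^ m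
    - (Complex.exp (-(β + ξ * (1 - dFun lam mu a h * α)) * V) - rFun lam mu a ξ V m α β h)
      / (dFun lam mu a h * α * ξ) ^ m

/-- The closed form `F(M₁, M)`, for `M₁ ≥ 1` and `M > M₁ + 1`. -/
noncomputable def closedForm (lam mu a ξ V : ℝ) (M₁ M : ℕ) (α β h : ℂ) : ℂ :=
  let c := cFun lam a h
  let d := dFun lam mu a h
  let l := lFun ξ β
  (a * mu * lam) ^ 2 * α ^ (M₁ + 1) * ξ ^ M₁ * c ^ (M₁ - 1)
      / ((1 - d * α * l) * (h + lam) ^ 2 * (mu + h + lam) ^ 2)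
    * (1 / (β + ξ * (1 - d * α)))
    * (l * bracket lam mu a ξ V (M₁ - 1) α β h
      + (l - 1 / (α * c)) * ∑ j ∈ Finset.Icc 1 (M - M₁ - 1),
          (c * α * ξ) ^ j * bracket lam mu a ξ V (M₁ + j - 1) α β h
      - (d * α * ξ) ^ (M - M₁) * (l + (l - 1 / (α * c)) * sFun lam mu a M₁ M h h)
          * bracket lam mu a ξ V (M - 1) α β h)

end NetworkAttack

/-!
The exit variable is decomposed according to the last observation `τ_m` before the passage. If
`ρ = m + 1` and `μ₁ < ρ`, then `N_m = k` with `M₁ < k ≤ M`, `W_m ≤ V`, and the next window brings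
`j` nodes with either `k + j > M` or `W_{m+1} > V`; summing over `m`, `k` and `j` recovers the
variable, because almost surely `N_m` exceeds `M` eventually
(`IsRegularOutcome.hasSum_exitTerm`, `IsExponentialModel.ae_exists_lt_cumNodes`).

The expectation of one such part factorizes (`IsExponentialModel.integral_nodes_weights`). The four
families are integrated out one after the other, each time freezing the others
(`integral_sum_random_index`): given the nodes lost, `W_m` and `W_{m+1} - W_m` are independent sums
of `k` and of `j` exponential weights; given the attack times, the node counts are independent sums
of geometric variables; given the observation times, the numbers of attacks in `[0, τ_m]` and in
`(τ_m, τ_{m+1}]` are independent Poisson variables. Each sum is then explicit.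

* Over `m`: the laws of `τ_1, τ_2, …` add up to `μ` times Lebesgue measure
  (`sum_sumLaw_expMeasure`), which replaces the law of `N_m` by the Laplace transform of
  `P{N(s) = k}` in `s`, namely `a λ c(h)^{k-1} / (λ + h)^2` (`nodeLaplace`, `integral_nodeProb`).
* Over `j`: passage in the window is the complement of staying below both thresholds, so that the
  weights contribute `E[e^{-β S_k}; S_k ≤ V] l(β)^j - E[e^{-β S_{k+j}}; S_{k+j} ≤ V] 1{k + j ≤ M}`
  (`integral_weightFactor`). The first part is a geometric series of ratio `d(h) α l(β)`, and the
  second is a finite sum (`hasSum_window`). The truncated transforms are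
  `l(β)^k P(k, (β + ξ)V)` (`integral_truncated_sumLaw`).
* Over `k`: the brackets satisfy
  `B_k - d(h) α ξ B_{k+1} = (β + ξ(1 - d(h)α)) P(k+1, (β + ξ)V) / (β + ξ)^{k+1}`
  (`bracket_sub_mul_bracket_succ`), so the inner finite sums telescope, and collecting the
  coefficient of each `B_k` gives the closed form (`closedForm_eq_sum`).
-/

namespace NetworkAttack

/-! ### The incomplete gamma function and Laplace transforms of monomials -/

/-- The truncated exponential series `e^{-w} ∑_{i ≤ n} w^i / i!`, i.e. `Γ(n + 1, w) / n!`. -/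
noncomputable def expTail (n : ℕ) (w : ℂ) : ℂ :=
  Complex.exp (-w) * ∑ i ∈ Finset.range (n + 1), w ^ i / (i.factorial : ℂ)

lemma expTail_zero (n : ℕ) : expTail n 0 = 1 := by
  simp [expTail, Finset.sum_range_succ']

lemma expTail_succ (n : ℕ) (w : ℂ) :
    expTail (n + 1) w
      = expTail n w + Complex.exp (-w) * (w ^ (n + 1) / ((n + 1).factorial : ℂ)) := by
  rw [expTail, Finset.sum_range_succ, mul_add, ← expTail]

lemma hasDerivAt_expTail (n : ℕ) (w : ℂ) :
    HasDerivAt (expTail n) (-(w ^ n / (n.factorial : ℂ) * Complex.exp (-w))) w := by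
  have hexp : HasDerivAt (fun w : ℂ => Complex.exp (-w)) (-Complex.exp (-w)) w := by
    simpa using (hasDerivAt_neg w).cexp
  induction n with
  | zero =>
    have : expTail 0 = fun w : ℂ => Complex.exp (-w) := by
      funext w; simp [expTail]
    rw [this]
    simpa using hexp
  | succ n ih =>
    have h1 : expTail (n + 1) = fun w => expTail n w
        + Complex.exp (-w) * (w ^ (n + 1) / ((n + 1).factorial : ℂ)) := by
      funext w; exact expTail_succ n w
    rw [h1]
    have h2 := (hasDerivAt_pow (n + 1) w).div_const ((n + 1).factorial : ℂ)
    refine (ih.add (hexp.mul h2)).congr_deriv ?_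
    have h3 : ((n.factorial : ℕ) : ℂ) ≠ 0 := by exact_mod_cast n.factorial_ne_zero
    have h4 : ((n : ℂ) + 1) ≠ 0 := by exact_mod_cast n.succ_ne_zero
    rw [Nat.factorial_succ]
    push_cast
    field_simp
    ring

lemma hasDerivAt_expTail_comp_affine (n : ℕ) (z s : ℂ) (r : ℝ) :
    HasDerivAt (fun r : ℝ => -expTail n (z + s * r))
      (s * ((z + s * r) ^ n / (n.factorial : ℂ) * Complex.exp (-(z + s * r)))) r := by
  have h1 : HasDerivAt (fun r : ℝ => z + s * (r : ℂ)) s r := by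
    simpa using ((Complex.ofRealCLM.hasDerivAt (x := r)).const_mul s).const_add z
  have h2 := ((hasDerivAt_expTail n (z + s * r)).comp r h1).neg
  refine h2.congr_deriv ?_
  ring

lemma norm_cexp_neg_mul_le {h : ℂ} (hh : 0 ≤ h.re) {x : ℝ} (hx : 0 ≤ x) :
    ‖Complex.exp (-h * x)‖ ≤ 1 := by
  rw [Complex.norm_exp]
  refine Real.exp_le_one_iff.2 ?_
  simp
  positivity

open Filter Asymptotics in
/-- A polynomial times `e^{-sr}` with `Re s > 0` decays exponentially. -/
lemma isBigO_pow_mul_cexp (n : ℕ) (z s : ℂ) (hs : 0 < s.re) :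
    (fun r : ℝ => (z + s * r) ^ n * Complex.exp (-(z + s * r)))
      =O[atTop] fun r : ℝ => Real.exp (-(s.re / 2) * r) := by
  have h1 : (fun r : ℝ => z + s * (r : ℂ)) =O[atTop] fun r : ℝ => r := by
    refine IsBigO.of_bound (‖z‖ + ‖s‖) ?_
    filter_upwards [eventually_ge_atTop 1] with r hr
    have : ‖(r : ℂ)‖ = r := by simp; linarith
    calc ‖z + s * (r : ℂ)‖ ≤ ‖z‖ + ‖s * (r : ℂ)‖ := norm_add_le _ _
      _ = ‖z‖ + ‖s‖ * r := by rw [norm_mul, this]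
      _ ≤ (‖z‖ + ‖s‖) * ‖r‖ := by
        rw [Real.norm_of_nonneg (by linarith)]
        nlinarith [norm_nonneg z]
  have h2 : (fun r : ℝ => Complex.exp (-(z + s * r))) =O[atTop]
      fun r : ℝ => Real.exp (-s.re * r) := by
    refine IsBigO.of_bound (Real.exp (-z.re)) (Eventually.of_forall fun r => ?_)
    rw [Complex.norm_exp, Real.norm_of_nonneg (Real.exp_pos _).le, ← Real.exp_add]
    refine Real.exp_le_exp.2 (le_of_eq ?_)
    simp
    ring
  have h3 := (isLittleO_pow_exp_pos_mul_atTop n (half_pos hs)).isBigO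
  refine ((h1.pow n).mul h2).trans ((h3.mul (isBigO_refl _ _)).trans (IsBigO.of_bound 1 ?_))
  refine Eventually.of_forall fun r => ?_
  rw [← Real.exp_add, one_mul]
  refine le_of_eq ?_
  congr 2
  ring

lemma integrableOn_pow_mul_cexp (n : ℕ) (z s : ℂ) (hs : 0 < s.re) :
    IntegrableOn (fun r : ℝ => s * ((z + s * r) ^ n / (n.factorial : ℂ)
      * Complex.exp (-(z + s * r)))) (Ioi 0) := by
  have h1 : IntegrableOn (fun r : ℝ => (z + s * r) ^ n * Complex.exp (-(z + s * r))) (Ioi 0) := by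
    have hc : Continuous (fun r : ℝ => (z + s * r) ^ n * Complex.exp (-(z + s * r))) := by fun_prop
    have := integrable_of_isBigO_exp_neg (a := 0) (half_pos hs) hc.norm.continuousOn
      (isBigO_pow_mul_cexp n z s hs).norm_left
    exact (integrable_norm_iff hc.aestronglyMeasurable).1 this
  refine (h1.const_mul (s / (n.factorial : ℂ))).congr (ae_of_all _ fun r => ?_)
  simp only
  ring

open Filter Topology in
lemma integral_pow_mul_cexp (n : ℕ) (z s : ℂ) (hs : 0 < s.re) :
    ∫ r in Ioi (0 : ℝ), s * ((z + s * r) ^ n / (n.factorial : ℂ) * Complex.exp (-(z + s * r)))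
      = expTail n z := by
  have hlim : Tendsto (fun r : ℝ => -expTail n (z + s * r)) atTop (𝓝 0) := by
    have h0 : Tendsto (fun r : ℝ => Real.exp (-(s.re / 2) * r)) atTop (𝓝 0) := by
      refine Real.tendsto_exp_atBot.comp ?_
      exact tendsto_id.const_mul_atTop_of_neg (by linarith)
    have h1 : ∀ i, Tendsto (fun r : ℝ => (z + s * r) ^ i * Complex.exp (-(z + s * r))
        / (i.factorial : ℂ)) atTop (𝓝 0) := fun i => by
      simpa using ((isBigO_pow_mul_cexp i z s hs).trans_tendsto h0).div_const (i.factorial : ℂ)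
    have h2 := (tendsto_finsetSum (Finset.range (n + 1)) fun i _ => h1 i).neg
    simp only [Finset.sum_const_zero, neg_zero] at h2
    refine h2.congr fun r => ?_
    rw [expTail, Finset.mul_sum]
    congr 1
    refine Finset.sum_congr rfl fun i _ => ?_
    ring
  have := integral_Ioi_of_hasDerivAt_of_tendsto'
    (fun r _ => hasDerivAt_expTail_comp_affine n z s r) (integrableOn_pow_mul_cexp n z s hs) hlim
  rw [this]
  simp

/-- The Laplace transform of a monomial at a complex point. -/
lemma integral_monomial_mul_cexp (n : ℕ) (s : ℂ) (hs : 0 < s.re) :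
    ∫ r in Ioi (0 : ℝ), (r : ℂ) ^ n / (n.factorial : ℂ) * Complex.exp (-(s * r))
      = 1 / s ^ (n + 1) := by
  have hs0 : s ≠ 0 := by rintro rfl; simp at hs
  have h := integral_pow_mul_cexp n 0 s hs
  rw [expTail_zero] at h
  rw [eq_div_iff (pow_ne_zero _ hs0), ← h, mul_comm, ← integral_const_mul]
  refine integral_congr_ae (ae_of_all _ fun r => ?_)
  simp only [zero_add]
  ring

lemma integrableOn_monomial_mul_cexp (n : ℕ) (s : ℂ) (hs : 0 < s.re) :
    IntegrableOn (fun r : ℝ => (r : ℂ) ^ n / (n.factorial : ℂ) * Complex.exp (-(s * r)))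
      (Ioi 0) := by
  have hs0 : s ≠ 0 := by rintro rfl; simp at hs
  refine ((integrableOn_pow_mul_cexp n 0 s hs).const_mul (1 / s ^ (n + 1))).congr
    (ae_of_all _ fun r => ?_)
  simp only [zero_add]
  field_simp
  ring

/-- `Γ(0) = 0` in Mathlib, so that the junk value of the quotient agrees with the convention
`P(0, z) = 1`. -/
lemma regGamma_zero (z : ℂ) : regGamma 0 z = 1 := by
  simp [regGamma, Complex.Gamma_zero]

lemma regGamma_succ (n : ℕ) (z : ℂ) : regGamma (n + 1 : ℕ) z = 1 - expTail n z := by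
  have h := integral_pow_mul_cexp n z 1 (by simp)
  have hn : ((n.factorial : ℕ) : ℂ) ≠ 0 := by exact_mod_cast n.factorial_ne_zero
  rw [regGamma, upperGamma, ← h]
  push_cast
  rw [Complex.Gamma_nat_eq_factorial, div_eq_inv_mul, ← integral_const_mul]
  congr 1
  refine integral_congr_ae (ae_of_all _ fun r => ?_)
  simp only [one_mul, add_sub_cancel_right, Complex.cpow_natCast]
  field_simp

/-- `P(k, z) - P(k + 1, z) = e^{-z} z^k / k!`. -/
lemma regGamma_sub_regGamma_succ (k : ℕ) (z : ℂ) :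
    regGamma k z - regGamma (k + 1 : ℕ) z = Complex.exp (-z) * (z ^ k / (k.factorial : ℂ)) := by
  cases k with
  | zero => rw [regGamma_succ, Nat.cast_zero, regGamma_zero]; simp [expTail]
  | succ k => rw [regGamma_succ, regGamma_succ, expTail_succ]; ring

/-- The truncated Laplace transform of a monomial. -/
lemma intervalIntegral_monomial_mul_cexp (n : ℕ) (s : ℂ) (V : ℝ) :
    ∫ r in (0 : ℝ)..V, s ^ (n + 1) * ((r : ℂ) ^ n / (n.factorial : ℂ)) * Complex.exp (-(s * r))
      = regGamma (n + 1 : ℕ) (s * V) := by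
  have := intervalIntegral.integral_eq_sub_of_hasDerivAt (a := 0) (b := V)
    (fun r _ => hasDerivAt_expTail_comp_affine n 0 s r)
    (Continuous.intervalIntegrable (by fun_prop) _ _)
  rw [regGamma_succ]
  simp only [zero_add, Complex.ofReal_zero, mul_zero, expTail_zero] at this
  rw [sub_eq_neg_add, ← sub_neg_eq_add, ← this]
  refine intervalIntegral.integral_congr fun r _ => ?_
  ring

/-! ### Algebra of the closed form -/

lemma lam_add_ne_zero {lam : ℝ} {θ : ℂ} (hlam : 0 < lam) (hθ : 0 ≤ θ.re) : (lam : ℂ) + θ ≠ 0 := by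
  intro h
  have := congrArg Complex.re h
  simp at this
  linarith

/-- `d(θ) = c(μ + θ)`. -/
lemma dFun_eq_cFun (lam mu a : ℝ) (θ : ℂ) : dFun lam mu a θ = cFun lam a (mu + θ) := by
  simp [dFun, cFun, add_assoc]

lemma cFun_ne_zero {lam a : ℝ} {θ : ℂ} (hlam : 0 < lam) (ha' : a ≤ 1) (hθ : 0 ≤ θ.re) :
    cFun lam a θ ≠ 0 := by
  refine div_ne_zero (fun h => ?_) (lam_add_ne_zero hlam hθ)
  have := congrArg Complex.re h
  simp at this
  nlinarith

lemma norm_cFun_lt_one {lam a : ℝ} {θ : ℂ} (hlam : 0 < lam) (ha : 0 < a) (ha' : a ≤ 1)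
    (hθ : 0 < θ.re) : ‖cFun lam a θ‖ < 1 := by
  rw [cFun, norm_div, div_lt_one (norm_pos_iff.2 (lam_add_ne_zero hlam hθ.le))]
  refine (sq_lt_sq₀ (norm_nonneg _) (norm_nonneg _)).1 ?_
  rw [← Complex.normSq_eq_norm_sq, ← Complex.normSq_eq_norm_sq, Complex.normSq_apply,
    Complex.normSq_apply]
  simp
  have h1 : (1 - a) * θ.re < θ.re := by nlinarith
  have h2 : 0 ≤ (1 - a) * θ.re := mul_nonneg (by linarith) hθ.le
  have h3 : ((1 - a) * θ.im) * ((1 - a) * θ.im) ≤ θ.im * θ.im := by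
    nlinarith [mul_self_nonneg θ.im, mul_nonneg (mul_nonneg ha.le (by linarith : 0 ≤ 2 - a))
      (mul_self_nonneg θ.im)]
  nlinarith

lemma norm_lFun_le_one {ξ : ℝ} {β : ℂ} (hξ : 0 < ξ) (hβ : 0 ≤ β.re) : ‖lFun ξ β‖ ≤ 1 := by
  rw [lFun, norm_div, div_le_one (norm_pos_iff.2 (lam_add_ne_zero hξ hβ))]
  calc ‖(ξ : ℂ)‖ = ξ := by simp [abs_of_pos hξ]
    _ ≤ (ξ + β).re := by simp [hβ]
    _ ≤ ‖(ξ : ℂ) + β‖ := Complex.re_le_norm _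

/-- `P(m, (β + ξ)V) / (β + ξ)^m`, the truncated Laplace transform of `x^{m-1} e^{-ξ x} / (m-1)!`. -/
noncomputable def gammaRatio (ξ V : ℝ) (β : ℂ) (m : ℕ) : ℂ :=
  regGamma m ((β + ξ) * V) / (β + ξ) ^ m

/-- The two-term recursion behind the cancellation of the factor `β + ξ(1 - d(h)α)`. -/
lemma bracket_sub_mul_bracket_succ (lam mu a ξ V : ℝ) (m : ℕ) {α β h : ℂ}
    (hβξ : β + ξ ≠ 0) (hdα : dFun lam mu a h * α * ξ ≠ 0) :
    bracket lam mu a ξ V m α β h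
        - dFun lam mu a h * α * ξ * bracket lam mu a ξ V (m + 1) α β h
      = (β + ξ * (1 - dFun lam mu a h * α)) * gammaRatio ξ V β (m + 1) := by
  have hP := regGamma_sub_regGamma_succ m ((β + ξ) * V)
  have hr : rFun lam mu a ξ V (m + 1) α β h = rFun lam mu a ξ V m α β h
      + Complex.exp (-(β + ξ) * V)
        * ((dFun lam mu a h * α * ξ) ^ m * V ^ m / (m.factorial : ℂ)) := by
    rw [rFun, rFun, Finset.sum_range_succ, mul_add, ← mul_pow]
    congr 4
    ring
  rw [bracket, bracket, gammaRatio, hr, eq_add_of_sub_eq hP, mul_pow, ← neg_mul]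
  set x := dFun lam mu a h * α * ξ with hx
  have hD : β + ξ * (1 - dFun lam mu a h * α) = β + ξ - x := by rw [hx]; ring
  rw [hD]
  field_simp
  ring

/-- The finite sum of the values `H_i` that the passage decomposition produces is a combination of
a sequence `B` with `D H_{k+1} = B_k - d B_{k+1}`. The induction is on the number of levels between
the two thresholds. -/
lemma sum_telescope (c d A D : ℂ) (H B : ℕ → ℂ) (hHB : ∀ k, D * H (k + 1) = B k - d * B (k + 1))
    (m L : ℕ) :
    D * ∑ k ∈ Finset.range L, c ^ k * (A * H (m + k + 1)
        - (1 - d * A) * ∑ i ∈ Finset.range (L - 1 - k), d ^ i * H (m + k + 1 + i + 1))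
      = ∑ k ∈ Finset.range L, c ^ k * (A * B (m + k) - B (m + k + 1)
        + (1 - d * A) * (d ^ (L - 1 - k) * B (m + L))) := by
  have key : ∀ p n, D * ∑ i ∈ Finset.range n, d ^ i * H (p + i + 1) = B p - d ^ n * B (p + n) := by
    intro p n
    induction n with
    | zero => simp
    | succ n ih =>
      rw [Finset.sum_range_succ, mul_add, ih]
      linear_combination d ^ n * hHB (p + n)
  rw [Finset.mul_sum]
  refine Finset.sum_congr rfl fun k hk => ?_
  have h1 := key (m + k + 1) (L - 1 - k)
  have h2 : m + k + 1 + (L - 1 - k) = m + L := by have := Finset.mem_range.1 hk; omega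
  rw [h2] at h1
  linear_combination c ^ k * A * hHB (m + k) - c ^ k * (1 - d * A) * h1

/-- Collecting the coefficients of each `B_i`. -/
lemma sum_collect (c d A : ℂ) (hc : c ≠ 0) (hd : d ≠ 0) (B : ℕ → ℂ) (m L : ℕ) (hL : 1 ≤ L) :
    ∑ k ∈ Finset.range L, c ^ k * (A * B (m + k) - B (m + k + 1)
        + (1 - d * A) * (d ^ (L - 1 - k) * B (m + L)))
      = A * B m + (A - 1 / c) * ∑ j ∈ Finset.Icc 1 (L - 1), c ^ j * B (m + j)
        - d ^ L * (A + (A - 1 / c) * ∑ j ∈ Finset.Icc 1 (L - 1), (c / d) ^ j) * B (m + L) := by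
  obtain ⟨n, rfl⟩ : ∃ n, L = n + 1 := ⟨L - 1, by omega⟩
  simp only [Nat.add_sub_cancel]
  have hIcc : ∀ f : ℕ → ℂ, ∑ j ∈ Finset.Icc 1 n, f j = ∑ j ∈ Finset.range n, f (j + 1) := by
    intro f
    rw [Finset.sum_bij' (fun j _ => j - 1) (fun j _ => j + 1)]
    · intro j hj; simp only [Finset.mem_Icc, Finset.mem_range] at hj ⊢; omega
    · intro j hj; simp only [Finset.mem_Icc, Finset.mem_range] at hj ⊢; omega
    · intro j hj; exact Nat.sub_add_cancel (Finset.mem_Icc.1 hj).1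
    · intro j _; rfl
    · intro j hj; rw [Nat.sub_add_cancel (Finset.mem_Icc.1 hj).1]
  have hgeom : ∑ k ∈ Finset.range (n + 1), c ^ k * d ^ (n - k)
      = d ^ n * (1 + ∑ j ∈ Finset.range n, (c / d) ^ (j + 1)) := by
    rw [Finset.sum_range_succ', mul_add, Finset.mul_sum, add_comm]
    simp only [pow_zero, one_mul, mul_one, Nat.sub_zero]
    congr 1
    refine Finset.sum_congr rfl fun j hj => ?_
    have hj' := Finset.mem_range.1 hj
    have : d ^ n = d ^ (n - (j + 1)) * d ^ (j + 1) := by rw [← pow_add]; congr 1; omega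
    rw [div_pow, this]
    field_simp
  have hgeom' : ∑ j ∈ Finset.range n, (c / d) ^ (j + 1) * d ^ (n + 1)
      = c * (∑ k ∈ Finset.range (n + 1), c ^ k * d ^ (n - k)) - c ^ (n + 1) := by
    rw [Finset.sum_range_succ, Nat.sub_self, mul_add, Finset.mul_sum, pow_zero]
    have : ∀ j ∈ Finset.range n, (c / d) ^ (j + 1) * d ^ (n + 1) = c * (c ^ j * d ^ (n - j)) := by
      intro j hj
      have hj' := Finset.mem_range.1 hj
      have : d ^ (n + 1) = d ^ (n - j) * d ^ (j + 1) := by rw [← pow_add]; congr 1; omega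
      rw [div_pow, this]
      field_simp
      ring
    rw [Finset.sum_congr rfl this]
    ring
  rw [← Finset.sum_mul] at hgeom'
  have hB : ∑ k ∈ Finset.range (n + 1), c ^ k * (A * B (m + k) - B (m + k + 1))
      = A * B m + (A - 1 / c) * ∑ j ∈ Finset.range n, c ^ (j + 1) * B (m + (j + 1))
        - c ^ n * B (m + n + 1) := by
    have h1 : ∑ k ∈ Finset.range (n + 1), c ^ k * (A * B (m + k))
        = A * B m + A * ∑ j ∈ Finset.range n, c ^ (j + 1) * B (m + (j + 1)) := by
      rw [Finset.sum_range_succ', Finset.mul_sum, add_comm]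
      simp only [pow_zero, one_mul, Nat.add_zero]
      congr 1
      exact Finset.sum_congr rfl fun j _ => by ring
    have h2 : ∑ k ∈ Finset.range (n + 1), c ^ k * B (m + k + 1)
        = 1 / c * ∑ j ∈ Finset.range n, c ^ (j + 1) * B (m + (j + 1)) + c ^ n * B (m + n + 1) := by
      rw [Finset.sum_range_succ, Finset.mul_sum]
      congr 1
      refine Finset.sum_congr rfl fun j _ => ?_
      rw [← add_assoc]
      field_simp
      ring
    simp only [mul_sub, Finset.sum_sub_distrib]
    rw [h1, h2]
    ring
  simp only [hIcc]
  have hsplit : ∑ k ∈ Finset.range (n + 1), c ^ k * (A * B (m + k) - B (m + k + 1)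
        + (1 - d * A) * (d ^ (n - k) * B (m + (n + 1))))
      = ∑ k ∈ Finset.range (n + 1), c ^ k * (A * B (m + k) - B (m + k + 1))
        + (1 - d * A) * (∑ k ∈ Finset.range (n + 1), c ^ k * d ^ (n - k)) * B (m + (n + 1)) := by
    rw [Finset.mul_sum, Finset.sum_mul, ← Finset.sum_add_distrib]
    exact Finset.sum_congr rfl fun j _ => by ring
  rw [hsplit, hB]
  set S := ∑ k ∈ Finset.range (n + 1), c ^ k * d ^ (n - k)
  set T := ∑ j ∈ Finset.range n, (c / d) ^ (j + 1)
  have e1 : d ^ (n + 1) * T = c * S - c ^ (n + 1) := by rw [← hgeom']; ring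
  have e2 : d ^ (n + 1) * (1 + T) = S * d := by rw [hgeom]; ring
  have e3 : 1 / c * (d ^ (n + 1) * T) = S - c ^ n := by
    rw [e1]; field_simp; ring
  rw [← add_assoc m n 1]
  have e4 : d ^ (n + 1) * (A + (A - 1 / c) * T) = A * (S * d) - 1 / c * (d ^ (n + 1) * T) := by
    rw [← e2]; ring
  rw [e4, e3]
  ring

/-- `∫_0^∞ e^{-θ s} P{N(s) = k} ds`, where `N(s)` is the number of nodes lost up to time `s`; see
`integral_nodeProb`. -/
noncomputable def nodeLaplace (lam a : ℝ) (k : ℕ) (θ : ℂ) : ℂ :=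
  if k = 0 then 1 / (lam + θ) else a * lam / (lam + θ) ^ 2 * cFun lam a θ ^ (k - 1)

lemma nodeLaplace_succ (lam a : ℝ) (k : ℕ) (θ : ℂ) :
    nodeLaplace lam a (k + 1) θ = a * lam / (lam + θ) ^ 2 * cFun lam a θ ^ k := by
  simp [nodeLaplace]

/-- `ξ^m` times `gammaRatio`, i.e. `E[e^{-β S_m}; S_m ≤ V]` for `S_m` a sum of `m` weights. -/
noncomputable def truncLaplace (ξ V : ℝ) (β : ℂ) (m : ℕ) : ℂ :=
  lFun ξ β ^ m * regGamma m ((β + ξ) * V)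

lemma truncLaplace_eq (ξ V : ℝ) (β : ℂ) (m : ℕ) :
    truncLaplace ξ V β m = ξ ^ m * gammaRatio ξ V β m := by
  rw [truncLaplace, gammaRatio, lFun, div_pow, add_comm (ξ : ℂ) β]
  ring

/-- The closed form as a sum over the number `M₁ + i + 1` of nodes lost at the last observation
before the passage. -/
lemma closedForm_eq_sum (lam mu a ξ V : ℝ) (hlam : 0 < lam) (hmu : 0 < mu) (ha : 0 < a)
    (ha' : a ≤ 1) (hξ : 0 < ξ) (M₁ L : ℕ) (hL : 1 ≤ L) (α β h : ℂ) (hα : α ≠ 0) (hα' : ‖α‖ ≤ 1)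
    (hβ : 0 ≤ β.re) (hh : 0 ≤ h.re) :
    closedForm lam mu a ξ V (M₁ + 1) (M₁ + L + 1) α β h
      = ∑ i ∈ Finset.range L, mu * nodeLaplace lam a (M₁ + i + 1) h
          * (mu * (a * lam / (lam + (mu + h)) ^ 2))
          * (α * lFun ξ β / (1 - dFun lam mu a h * (α * lFun ξ β))
              * (α ^ (M₁ + i + 1) * truncLaplace ξ V β (M₁ + i + 1))
            - ∑ j ∈ Finset.range (L - 1 - i), dFun lam mu a h ^ j
              * (α ^ (M₁ + i + 1 + j + 1) * truncLaplace ξ V β (M₁ + i + 1 + j + 1))) := by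
  have hmh : 0 < ((mu : ℂ) + h).re := by simp; linarith
  have hc := cFun_ne_zero hlam ha' hh
  have hd : dFun lam mu a h ≠ 0 := by rw [dFun_eq_cFun]; exact cFun_ne_zero hlam ha' hmh.le
  have hd1 : ‖dFun lam mu a h‖ < 1 := by rw [dFun_eq_cFun]; exact norm_cFun_lt_one hlam ha ha' hmh
  have hl := norm_lFun_le_one hξ hβ
  have hξβ := lam_add_ne_zero hξ hβ
  have hξ0 : (ξ : ℂ) ≠ 0 := by exact_mod_cast hξ.ne'
  set c := cFun lam a h with hcdef
  set d := dFun lam mu a h with hddef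
  have hdA : 1 - d * (α * lFun ξ β) ≠ 0 := by
    intro h0
    have h1 : ‖d * (α * lFun ξ β)‖ < 1 := by
      rw [norm_mul, norm_mul]
      have : ‖α‖ * ‖lFun ξ β‖ ≤ 1 := mul_le_one₀ hα' (norm_nonneg _) hl
      nlinarith [norm_nonneg d, norm_nonneg (lFun ξ β), norm_nonneg α]
    rw [← sub_eq_zero.1 h0] at h1
    simp at h1
  have hD : β + ξ * (1 - d * α) = (ξ + β) * (1 - d * (α * lFun ξ β)) := by
    rw [lFun]; field_simp; ring
  have hD0 : β + ξ * (1 - d * α) ≠ 0 := by rw [hD]; exact mul_ne_zero hξβ hdA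
  set D := β + ξ * (1 - d * α) with hDdef
  set H : ℕ → ℂ := fun k => α ^ k * truncLaplace ξ V β k with hH
  set B : ℕ → ℂ := fun k => (α * ξ) ^ (k + 1) * bracket lam mu a ξ V k α β h with hB
  -- the power of `α ξ` in `B` turns the recursion of the brackets into one with ratio `d`
  have hHB : ∀ k, D * H (k + 1) = B k - d * B (k + 1) := by
    intro k
    have := bracket_sub_mul_bracket_succ lam mu a ξ V k (α := α) (β := β) (h := h)
      (by rwa [add_comm]) (mul_ne_zero (mul_ne_zero hd hα) hξ0)
    simp only [hH, hB, truncLaplace_eq]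
    rw [← hddef, ← hDdef] at this
    rw [pow_succ (α * ξ) (k + 1), mul_pow]
    linear_combination -α ^ (k + 1) * ξ ^ (k + 1) * this
  have h1 := sum_telescope c d (α * lFun ξ β) D H B hHB M₁ L
  rw [sum_collect c d (α * lFun ξ β) hc hd B M₁ L hL] at h1
  have h2 : ∑ i ∈ Finset.range L, mu * nodeLaplace lam a (M₁ + i + 1) h
          * (mu * (a * lam / (lam + (mu + h)) ^ 2))
          * (α * lFun ξ β / (1 - d * (α * lFun ξ β)) * H (M₁ + i + 1)
            - ∑ j ∈ Finset.range (L - 1 - i), d ^ j * H (M₁ + i + 1 + j + 1))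
      = (a * mu * lam) ^ 2 * c ^ M₁ / ((1 - d * (α * lFun ξ β)) * (h + lam) ^ 2
          * (mu + h + lam) ^ 2) * (1 / D) * (D * ∑ k ∈ Finset.range L, c ^ k *
          (α * lFun ξ β * H (M₁ + k + 1) - (1 - d * (α * lFun ξ β))
            * ∑ i ∈ Finset.range (L - 1 - k), d ^ i * H (M₁ + k + 1 + i + 1))) := by
    have hlh := lam_add_ne_zero hlam hh
    have hlmh := lam_add_ne_zero hlam hmh.le
    have hx : ∀ X Y : ℂ, X * (1 / D) * (D * Y) = X * Y := fun X Y => by field_simp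
    rw [hx, Finset.mul_sum]
    refine Finset.sum_congr rfl fun i _ => ?_
    rw [nodeLaplace_succ, ← hcdef, pow_add, show h + (lam : ℂ) = lam + h by ring,
      show (mu : ℂ) + h + lam = lam + (mu + h) by ring]
    generalize 1 - d * (α * lFun ξ β) = E at hdA ⊢
    field_simp
  rw [h2, h1, closedForm]
  have e1 : M₁ + L + 1 - (M₁ + 1) = L := by omega
  simp only [← hcdef, ← hddef, ← hDdef, sFun, Nat.add_sub_cancel, e1]
  have e2 : ∀ j ∈ Finset.Icc 1 (L - 1),
      (c * α * ξ) ^ j * bracket lam mu a ξ V (M₁ + 1 + j - 1) α β h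
      = 1 / (α * ξ) ^ (M₁ + 1) * (c ^ j * B (M₁ + j)) := by
    intro j _
    have : M₁ + 1 + j - 1 = M₁ + j := by omega
    rw [this]
    simp only [hB]
    rw [show M₁ + j + 1 = M₁ + 1 + j by ring, pow_add, mul_pow, mul_pow c, mul_pow, mul_pow]
    field_simp
    ring
  have e3 : bracket lam mu a ξ V M₁ α β h = 1 / (α * ξ) ^ (M₁ + 1) * B M₁ := by
    simp only [hB]
    field_simp
  have e4 : (d * α * ξ) ^ L * bracket lam mu a ξ V (M₁ + L) α β h
      = 1 / (α * ξ) ^ (M₁ + 1) * (d ^ L * B (M₁ + L)) := by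
    simp only [hB]
    rw [show M₁ + L + 1 = M₁ + 1 + L by ring, pow_add, mul_pow, mul_pow d, mul_pow, mul_pow]
    field_simp
    ring
  rw [Finset.sum_congr rfl e2, e3, ← Finset.mul_sum, mul_right_comm ((d * α * ξ) ^ L), e4]
  rw [show d * (α * lFun ξ β) = d * α * lFun ξ β by ring] at hdA ⊢
  have e5 : α ^ (M₁ + 1 + 1) * (ξ : ℂ) ^ (M₁ + 1) = α * (α * ξ) ^ (M₁ + 1) := by
    rw [mul_pow]; ring
  have e6 : α * lFun ξ β - 1 / c = α * (lFun ξ β - 1 / (α * c)) := by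
    field_simp
  rw [e6]
  have e7 : (α * ξ) ^ (M₁ + 1) ≠ 0 := pow_ne_zero _ (mul_ne_zero hα hξ0)
  calc _ = (a * mu * lam) ^ 2 * (α ^ (M₁ + 1 + 1) * (ξ : ℂ) ^ (M₁ + 1)) * c ^ M₁
          / ((1 - d * α * lFun ξ β) * (h + lam) ^ 2 * (mu + h + lam) ^ 2) * (1 / D)
          * (1 / (α * ξ) ^ (M₁ + 1) * (lFun ξ β * B M₁ + (lFun ξ β - 1 / (α * c))
            * ∑ j ∈ Finset.Icc 1 (L - 1), c ^ j * B (M₁ + j)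
            - d ^ L * B (M₁ + L) * (lFun ξ β + (lFun ξ β - 1 / (α * c))
              * ∑ i ∈ Finset.Icc 1 (L - 1), (c / d) ^ i))) := by ring
    _ = _ := by
      rw [e5]
      generalize (α * ξ : ℂ) ^ (M₁ + 1) = x at e7
      field_simp

/-! ### Sums of independent variables -/

open scoped ENNReal

section SumLaw

variable {G : Type*} [AddCommMonoid G] [MeasurableSpace G] [MeasurableAdd₂ G]

/-- The law of a sum of `k` independent variables of law `ν`: the `k`-fold convolution power. -/
noncomputable def sumLaw (ν : Measure G) : ℕ → Measure G
  | 0 => Measure.dirac 0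
  | k + 1 => (sumLaw ν k).conv ν

instance isProbabilityMeasure_sumLaw (ν : Measure G) [IsProbabilityMeasure ν] (k : ℕ) :
    IsProbabilityMeasure (sumLaw ν k) := by
  induction k with
  | zero => rw [sumLaw]; infer_instance
  | succ k ih => rw [sumLaw]; infer_instance

/-- A convolution power of an exponent splits as a convolution. -/
lemma sumLaw_add (ν : Measure G) [IsProbabilityMeasure ν] (j k : ℕ) :
    sumLaw ν (j + k) = (sumLaw ν j).conv (sumLaw ν k) := by
  induction k with
  | zero => rw [sumLaw, Measure.conv_dirac_zero, Nat.add_zero]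
  | succ k ih =>
    rw [← Nat.add_assoc, sumLaw, ih, Measure.conv_assoc, ← sumLaw]

lemma map_sum_eq_sumLaw {Ω ι : Type*} [MeasurableSpace Ω] {P : Measure Ω} [IsProbabilityMeasure P]
    {ν : Measure G} {X : ι → Ω → G} (hX : ∀ i, Measurable (X i)) (hlaw : ∀ i, P.map (X i) = ν)
    (hind : iIndepFun X P) (s : Finset ι) :
    P.map (fun ω => ∑ i ∈ s, X i ω) = sumLaw ν s.card := by
  classical
  induction s using Finset.induction_on with
  | empty => simp [sumLaw]
  | insert i s hi ih =>
    have h1 : (fun ω => ∑ j ∈ insert i s, X j ω) = (∑ j ∈ s, X j) + X i := by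
      funext ω
      simp [Finset.sum_insert hi, add_comm]
    have h2 : P.map (∑ j ∈ s, X j) = sumLaw ν s.card := by
      rw [← ih]
      congr 1
      funext ω
      simp
    rw [h1, Finset.card_insert_of_notMem hi, sumLaw, ← h2, ← hlaw i]
    exact (hind.indepFun_finsetSum_of_notMem hX hi).map_add_eq_map_conv_map
      (by fun_prop) (hX i)

/-- The sums over two disjoint index sets are independent. -/
lemma map_sum_prod_sum {Ω ι : Type*} [MeasurableSpace Ω] {P : Measure Ω} [IsProbabilityMeasure P]
    {ν : Measure G} {X : ι → Ω → G} (hX : ∀ i, Measurable (X i)) (hlaw : ∀ i, P.map (X i) = ν)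
    (hind : iIndepFun X P) (s s' : Finset ι) (hs : Disjoint s s') :
    P.map (fun ω => (∑ i ∈ s, X i ω, ∑ i ∈ s', X i ω))
      = (sumLaw ν s.card).prod (sumLaw ν s'.card) := by
  have hi : IndepFun (fun ω => ∑ i ∈ s, X i ω) (fun ω => ∑ i ∈ s', X i ω) P := by
    have h := hind.indepFun_finset s s' hs hX
    have h' := h.comp (φ := fun x : s → G => ∑ i, x i) (ψ := fun x : s' → G => ∑ i, x i)
      (by fun_prop) (by fun_prop)
    refine h'.congr (ae_of_all _ fun ω => ?_) (ae_of_all _ fun ω => ?_)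
    · exact Finset.sum_coe_sort s fun i => X i ω
    · exact Finset.sum_coe_sort s' fun i => X i ω
  rw [hi.map_prod_eq_prod_map_map (Finset.measurable_fun_sum _ fun j _ => hX j).aemeasurable
    (Finset.measurable_fun_sum _ fun j _ => hX j).aemeasurable, map_sum_eq_sumLaw hX hlaw hind,
    map_sum_eq_sumLaw hX hlaw hind]

end SumLaw

/-! ### Sums of exponential variables -/

/-- The density of a sum of `k + 1` independent exponential variables of rate `r`. -/
noncomputable def erlangPDF (r : ℝ) (k : ℕ) : ℝ → ℝ≥0∞ :=
  (Ici 0).indicator fun x =>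
    ENNReal.ofReal (r ^ (k + 1) * (x ^ k / k.factorial) * Real.exp (-(r * x)))

lemma measurable_erlangPDF (r : ℝ) (k : ℕ) : Measurable (erlangPDF r k) :=
  Measurable.indicator (by fun_prop) measurableSet_Ici

lemma expMeasure_eq_withDensity (r : ℝ) : expMeasure r = volume.withDensity (erlangPDF r 0) := by
  rw [expMeasure, gammaMeasure]
  congr 1
  funext x
  rw [gammaPDF_eq, erlangPDF, indicator_apply]
  simp only [mem_Ici]
  split_ifs <;> simp

lemma lconvolution_erlangPDF {r : ℝ} (hr : 0 < r) (k : ℕ) :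
    lconvolution (erlangPDF r k) (erlangPDF r 0) volume = erlangPDF r (k + 1) := by
  funext x
  rw [lconvolution_def]
  rcases lt_or_ge x 0 with hx | hx
  · rw [erlangPDF, erlangPDF, erlangPDF, indicator_of_notMem (by simpa using hx)]
    refine (lintegral_congr fun y => ?_).trans lintegral_zero
    by_cases hy : 0 ≤ y
    · rw [indicator_of_notMem (a := -y + x) (by simp; linarith), mul_zero]
    · rw [indicator_of_notMem (a := y) (by simpa using hy), zero_mul]
  · have h1 : ∀ y, erlangPDF r k y * erlangPDF r 0 (-y + x) = (Icc 0 x).indicator (fun y =>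
        ENNReal.ofReal (r ^ (k + 2) * Real.exp (-(r * x)) / k.factorial * y ^ k)) y := by
      intro y
      by_cases hy : y ∈ Icc 0 x
      · have h0 : 0 ≤ y := hy.1
        rw [indicator_of_mem hy, erlangPDF, erlangPDF, indicator_of_mem (a := y) (mem_Ici.2 hy.1),
          indicator_of_mem (a := -y + x) (by simpa using hy.2),
          ← ENNReal.ofReal_mul (by positivity)]
        congr 1
        have : Real.exp (-(r * x)) = Real.exp (-(r * y)) * Real.exp (-(r * (-y + x))) := by
          rw [← Real.exp_add]; ring_nf
        rw [this]
        simp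
        ring
      · rw [indicator_of_notMem hy, erlangPDF, erlangPDF]
        by_cases hy0 : 0 ≤ y
        · rw [indicator_of_notMem (a := -y + x), mul_zero]
          simp only [mem_Icc, not_and, not_le] at hy
          simpa using hy hy0
        · rw [indicator_of_notMem (a := y) (by simpa using hy0), zero_mul]
    rw [lintegral_congr h1, lintegral_indicator measurableSet_Icc,
      ← ofReal_integral_eq_lintegral_ofReal, erlangPDF, indicator_of_mem (by simpa using hx),
      integral_Icc_eq_integral_Ioc, ← intervalIntegral.integral_of_le hx,
      intervalIntegral.integral_const_mul, integral_pow]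
    · congr 1
      rw [Nat.factorial_succ]
      push_cast
      field_simp
      simp
    · exact (Continuous.integrableOn_Icc (by fun_prop))
    · refine (ae_restrict_iff' measurableSet_Icc).2 (ae_of_all _ fun y hy => ?_)
      have := hy.1
      simp only [Pi.zero_apply]
      positivity

lemma sumLaw_expMeasure_succ {r : ℝ} (hr : 0 < r) (k : ℕ) :
    sumLaw (expMeasure r) (k + 1) = volume.withDensity (erlangPDF r k) := by
  induction k with
  | zero =>
    have := isProbabilityMeasure_expMeasure hr
    rw [sumLaw, sumLaw, Measure.dirac_zero_conv, expMeasure_eq_withDensity]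
  | succ k ih =>
    rw [sumLaw, ih, expMeasure_eq_withDensity,
      conv_withDensity_eq_lconvolution (measurable_erlangPDF r k) (measurable_erlangPDF r 0),
      lconvolution_erlangPDF hr]

lemma ae_nonneg_expMeasure (r : ℝ) : ∀ᵐ x ∂expMeasure r, 0 ≤ x := by
  rw [expMeasure_eq_withDensity, ae_withDensity_iff (measurable_erlangPDF r 0)]
  refine ae_of_all _ fun x hx => ?_
  by_contra h
  exact hx (indicator_of_notMem h _)

lemma ae_nonneg_sumLaw_expMeasure {r : ℝ} (hr : 0 < r) (k : ℕ) :
    ∀ᵐ x ∂sumLaw (expMeasure r) k, 0 ≤ x := by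
  cases k with
  | zero => rw [sumLaw, ae_dirac_eq]; exact le_refl (0 : ℝ)
  | succ k =>
    rw [sumLaw_expMeasure_succ hr, ae_withDensity_iff (measurable_erlangPDF r k)]
    refine ae_of_all _ fun x hx => ?_
    by_contra h
    exact hx (indicator_of_notMem h _)

lemma integral_sumLaw_expMeasure_succ {r : ℝ} (hr : 0 < r) (k : ℕ) (f : ℝ → ℂ) :
    ∫ x, f x ∂sumLaw (expMeasure r) (k + 1)
      = ∫ x : ℝ in Ici 0, ((r : ℂ) ^ (k + 1) * ((x : ℂ) ^ k / (k.factorial : ℂ))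
          * Complex.exp (-(r * x))) * f x := by
  rw [sumLaw_expMeasure_succ hr,
    integral_withDensity_eq_integral_toReal_smul (measurable_erlangPDF r k),
    ← integral_indicator measurableSet_Ici]
  · refine integral_congr_ae (ae_of_all _ fun x => ?_)
    by_cases hx : x ∈ Ici (0 : ℝ)
    · have h0 : 0 ≤ x := hx
      simp only [erlangPDF, indicator_of_mem hx]
      rw [ENNReal.toReal_ofReal (by positivity)]
      simp
    · simp only [erlangPDF, indicator_of_notMem hx]
      simp
  · refine ae_of_all _ fun x => ?_
    by_cases hx : x ∈ Ici (0 : ℝ) <;> simp [erlangPDF, hx]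

/-- `E[e^{-β S_k}; S_k ≤ V] = l(β)^k P(k, (β + ξ)V)` for a sum `S_k` of `k` exponential weights. -/
lemma integral_truncated_sumLaw {ξ V : ℝ} (hξ : 0 < ξ) (hV : 0 < V) {β : ℂ} (hβ : 0 ≤ β.re)
    (k : ℕ) :
    ∫ x, (Iic V).indicator (fun x : ℝ => Complex.exp (-β * x)) x ∂sumLaw (expMeasure ξ) k
      = truncLaplace ξ V β k := by
  cases k with
  | zero =>
    rw [sumLaw, integral_dirac, truncLaplace, Nat.cast_zero, regGamma_zero,
      indicator_of_mem (by simpa using hV.le)]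
    simp
  | succ k =>
    have hξβ := lam_add_ne_zero hξ hβ
    rw [integral_sumLaw_expMeasure_succ hξ, truncLaplace, ← intervalIntegral_monomial_mul_cexp,
      intervalIntegral.integral_of_le hV.le, ← integral_Icc_eq_integral_Ioc,
      ← integral_const_mul, ← integral_indicator measurableSet_Ici,
      ← integral_indicator measurableSet_Icc]
    refine integral_congr_ae (ae_of_all _ fun x => ?_)
    simp only [indicator_apply, mem_Ici, mem_Iic, mem_Icc]
    by_cases h0 : 0 ≤ x <;> by_cases h1 : x ≤ V <;> simp only [h0, h1, if_true, if_false, and_self,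
      and_false, false_and, mul_zero]
    have : Complex.exp (-((β + ξ) * x)) = Complex.exp (-(ξ * x)) * Complex.exp (-β * x) := by
      rw [← Complex.exp_add]; ring_nf
    rw [this, lFun, add_comm (ξ : ℂ) β, div_pow]
    rw [add_comm] at hξβ
    field_simp

/-- `E[e^{-β S_k}] = l(β)^k`. -/
lemma integral_cexp_sumLaw {ξ : ℝ} (hξ : 0 < ξ) {β : ℂ} (hβ : 0 ≤ β.re) (k : ℕ) :
    ∫ x, Complex.exp (-β * (x : ℝ)) ∂sumLaw (expMeasure ξ) k = lFun ξ β ^ k := by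
  cases k with
  | zero => simp [sumLaw]
  | succ k =>
    have hξβ := lam_add_ne_zero hξ hβ
    have h := integral_monomial_mul_cexp k (ξ + β) (by simp; linarith)
    rw [integral_sumLaw_expMeasure_succ hξ, lFun, div_pow, div_eq_mul_one_div, ← h,
      integral_Ici_eq_integral_Ioi, ← integral_const_mul]
    refine integral_congr_ae (ae_of_all _ fun x => ?_)
    have : Complex.exp (-((ξ + β) * x)) = Complex.exp (-(ξ * x)) * Complex.exp (-β * x) := by
      rw [← Complex.exp_add]; ring_nf
    simp only
    rw [this]
    ring

/-- The renewal measure of the observation process: the epochs `τ_1, τ_2, …` form a Poisson point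
process of rate `μ`. -/
lemma sum_sumLaw_expMeasure {r : ℝ} (hr : 0 < r) :
    Measure.sum (fun m => sumLaw (expMeasure r) (m + 1))
      = ENNReal.ofReal r • volume.restrict (Ici 0) := by
  simp only [sumLaw_expMeasure_succ hr]
  rw [← withDensity_tsum (measurable_erlangPDF r), ← withDensity_const,
    ← withDensity_indicator measurableSet_Ici]
  congr 1
  funext x
  rw [ENNReal.tsum_apply]
  by_cases hx : x ∈ Ici (0 : ℝ)
  · have h0 : 0 ≤ x := hx
    simp only [erlangPDF, indicator_of_mem hx]
    have h1 : HasSum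
        (fun k : ℕ => r ^ (k + 1) * (x ^ k / k.factorial) * Real.exp (-(r * x))) r := by
      have h2 := (NormedSpace.expSeries_div_hasSum_exp (r * x)).mul_left (r * Real.exp (-(r * x)))
      rw [← Real.exp_eq_exp_ℝ, mul_assoc, ← Real.exp_add, neg_add_cancel, Real.exp_zero,
        mul_one] at h2
      refine h2.congr_fun fun k => ?_
      rw [mul_pow]
      ring
    rw [← ENNReal.ofReal_tsum_of_nonneg (fun k => by positivity) h1.summable, h1.tsum_eq]
  · simp [erlangPDF, hx]

/-! ### The number of nodes lost over a time interval -/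

/-- The geometric law on `{1, 2, …}`: mass `a (1 - a)^{i-1}` at `i`. -/
noncomputable def geomLaw (a : ℝ) : Measure ℕ :=
  Measure.sum fun i : ℕ => ENNReal.ofReal (a * (1 - a) ^ i) • Measure.dirac (i + 1)

lemma geomLaw_singleton_zero (a : ℝ) : geomLaw a {0} = 0 := by
  simp [geomLaw]

lemma geomLaw_singleton_succ (a : ℝ) (i : ℕ) :
    geomLaw a {i + 1} = ENNReal.ofReal (a * (1 - a) ^ i) := by
  rw [geomLaw, Measure.sum_apply _ (measurableSet_singleton _), tsum_eq_single i]
  · simp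
  · intro j hj
    simp [hj]

lemma hasSum_geometric_mass {a : ℝ} (ha : 0 < a) (ha' : a ≤ 1) :
    HasSum (fun i : ℕ => a * (1 - a) ^ i) 1 := by
  have h := (hasSum_geometric_of_lt_one (r := 1 - a) (by linarith) (by linarith)).mul_left a
  rwa [sub_sub_cancel, mul_inv_cancel₀ ha.ne'] at h

lemma tsum_geometric_mass {a : ℝ} (ha : 0 < a) (ha' : a ≤ 1) :
    ∑' i : ℕ, ENNReal.ofReal (a * (1 - a) ^ i) = 1 := by
  rw [← ENNReal.ofReal_tsum_of_nonneg
    (fun i => mul_nonneg ha.le (pow_nonneg (by linarith) i))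
    (hasSum_geometric_mass ha ha').summable,
    (hasSum_geometric_mass ha ha').tsum_eq, ENNReal.ofReal_one]

lemma isProbabilityMeasure_geomLaw {a : ℝ} (ha : 0 < a) (ha' : a ≤ 1) :
    IsProbabilityMeasure (geomLaw a) := by
  constructor
  rw [geomLaw, Measure.sum_apply _ MeasurableSet.univ]
  simpa using tsum_geometric_mass ha ha'

/-- A probability measure on `ℕ` with the geometric masses on `{1, 2, …}` has no mass at `0`. -/
lemma eq_geomLaw {a : ℝ} (ha : 0 < a) (ha' : a ≤ 1) (ν : Measure ℕ) [IsProbabilityMeasure ν]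
    (hν : ∀ i, ν {i + 1} = ENNReal.ofReal (a * (1 - a) ^ i)) : ν = geomLaw a := by
  refine Measure.ext_of_singleton fun i => ?_
  cases i with
  | succ i => rw [hν, geomLaw_singleton_succ]
  | zero =>
    have h1 : ν univ = ν {0} + ∑' i : ℕ, ν {i + 1} := by
      rw [← tsum_eq_zero_add' ENNReal.summable (f := fun i => ν {i})]
      exact (Measure.tsum_indicator_apply_singleton ν univ MeasurableSet.univ).symm.trans
        (by simp)
    simp only [hν, tsum_geometric_mass ha ha', measure_univ] at h1
    rw [geomLaw_singleton_zero]
    have h2 : (0 : ℝ≥0∞) + 1 = ν {0} + 1 := by rw [zero_add]; exact h1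
    exact ((ENNReal.add_left_inj ENNReal.one_ne_top).1 h2).symm

/-- Lack of memory: a geometric variable is `1`, or, with probability `1 - a`, `1` plus an
independent copy of itself. -/
lemma geomLaw_eq {a : ℝ} (ha : 0 < a) (ha' : a ≤ 1) :
    geomLaw a = ENNReal.ofReal a • Measure.dirac 1
      + ENNReal.ofReal (1 - a) • (Measure.dirac 1).conv (geomLaw a) := by
  have := isProbabilityMeasure_geomLaw ha ha'
  rw [Measure.dirac_conv]
  refine Measure.ext_of_singleton fun i => ?_
  rw [Measure.add_apply, Measure.smul_apply, Measure.smul_apply,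
    Measure.map_apply (by fun_prop) (measurableSet_singleton _)]
  rcases i with _ | _ | i
  · have : (fun y => 1 + y) ⁻¹' {0} = (∅ : Set ℕ) := by ext y; simp
    rw [this, geomLaw_singleton_zero]
    simp
  · have : (fun y => 1 + y) ⁻¹' {0 + 1} = ({0} : Set ℕ) := by ext y; simp
    rw [this, geomLaw_singleton_zero, geomLaw_singleton_succ]
    simp
  · have : (fun y => 1 + y) ⁻¹' {i + 1 + 1} = ({i + 1} : Set ℕ) := by ext y; simp; omega
    rw [this, geomLaw_singleton_succ, geomLaw_singleton_succ, smul_eq_mul, smul_eq_mul,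
      ← ENNReal.ofReal_mul (by linarith)]
    simp
    congr 1
    ring

/-- The probability that `r` attacks destroy `k` nodes. -/
noncomputable def attackProb (a : ℝ) (r k : ℕ) : ℝ := (sumLaw (geomLaw a) r).real {k}

lemma attackProb_zero_zero (a : ℝ) : attackProb a 0 0 = 1 := by
  simp [attackProb, sumLaw, measureReal_def]

lemma attackProb_zero_succ (a : ℝ) (k : ℕ) : attackProb a 0 (k + 1) = 0 := by
  simp [attackProb, sumLaw, measureReal_def]

lemma sumLaw_geomLaw_succ {a : ℝ} (ha : 0 < a) (ha' : a ≤ 1) (r : ℕ) :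
    sumLaw (geomLaw a) (r + 1) = (ENNReal.ofReal a • sumLaw (geomLaw a) r
      + ENNReal.ofReal (1 - a) • sumLaw (geomLaw a) (r + 1)).map (fun y => 1 + y) := by
  have := isProbabilityMeasure_geomLaw ha ha'
  have h : ∀ ρ : Measure ℕ, SFinite ρ → ρ.map (fun y => 1 + y) = (Measure.dirac 1).conv ρ :=
    fun ρ _ => (Measure.dirac_conv 1 ρ).symm
  rw [h _ inferInstance, Measure.conv_add, Measure.conv_smul_right, Measure.conv_smul_right]
  have e : sumLaw (geomLaw a) (r + 1) = (sumLaw (geomLaw a) r).conv (geomLaw a) := rfl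
  rw [e]
  generalize hρ : sumLaw (geomLaw a) r = ρ at e ⊢
  have : SFinite ρ := by rw [← hρ]; infer_instance
  conv_lhs => rw [geomLaw_eq ha ha', Measure.conv_add, Measure.conv_smul_right,
    Measure.conv_smul_right, ← Measure.conv_assoc, Measure.conv_comm _ (Measure.dirac 1),
    Measure.conv_assoc]

lemma attackProb_succ_zero {a : ℝ} (ha : 0 < a) (ha' : a ≤ 1) (r : ℕ) :
    attackProb a (r + 1) 0 = 0 := by
  rw [attackProb, measureReal_def, sumLaw_geomLaw_succ ha ha',
    Measure.map_apply (by fun_prop) (measurableSet_singleton _)]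
  have : (fun y => 1 + y) ⁻¹' {0} = (∅ : Set ℕ) := by ext y; simp
  rw [this, measure_empty, ENNReal.toReal_zero]

lemma attackProb_succ_succ {a : ℝ} (ha : 0 < a) (ha' : a ≤ 1) (r k : ℕ) :
    attackProb a (r + 1) (k + 1) = a * attackProb a r k + (1 - a) * attackProb a (r + 1) k := by
  have := isProbabilityMeasure_geomLaw ha ha'
  have h : (fun y => 1 + y) ⁻¹' {k + 1} = ({k} : Set ℕ) := by ext y; simp; omega
  rw [attackProb, measureReal_def, sumLaw_geomLaw_succ ha ha',
    Measure.map_apply (by fun_prop) (measurableSet_singleton _), h, Measure.add_apply,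
    Measure.smul_apply, Measure.smul_apply, smul_eq_mul, smul_eq_mul,
    ENNReal.toReal_add (ENNReal.mul_ne_top ENNReal.ofReal_ne_top (measure_ne_top _ _))
      (ENNReal.mul_ne_top ENNReal.ofReal_ne_top (measure_ne_top _ _)),
    ENNReal.toReal_mul, ENNReal.toReal_mul, ENNReal.toReal_ofReal ha.le,
    ENNReal.toReal_ofReal (by linarith)]
  rfl

lemma attackProb_of_lt {a : ℝ} (ha : 0 < a) (ha' : a ≤ 1) {r k : ℕ} (h : k < r) :
    attackProb a r k = 0 := by
  induction k generalizing r with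
  | zero =>
    obtain ⟨r, rfl⟩ : ∃ s, r = s + 1 := ⟨r - 1, by omega⟩
    exact attackProb_succ_zero ha ha' r
  | succ k ih =>
    obtain ⟨r, rfl⟩ : ∃ s, r = s + 1 := ⟨r - 1, by omega⟩
    rw [attackProb_succ_succ ha ha', ih (by omega), ih (by omega)]
    ring

/-- The generating function of the number of attacks that destroy `k + 1` nodes. -/
lemma sum_attackProb_mul_pow {a : ℝ} (ha : 0 < a) (ha' : a ≤ 1) (z : ℂ) (k N : ℕ) (hN : k + 2 ≤ N) :
    ∑ r ∈ Finset.range N, (attackProb a r (k + 1) : ℂ) * z ^ r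
      = a * z * ((1 - a) + a * z) ^ k := by
  have hrec : ∀ k N, ∑ r ∈ Finset.range (N + 1), (attackProb a r (k + 1) : ℂ) * z ^ r
      = a * z * ∑ r ∈ Finset.range N, (attackProb a r k : ℂ) * z ^ r
        + (1 - a) * (∑ r ∈ Finset.range (N + 1), (attackProb a r k : ℂ) * z ^ r
          - attackProb a 0 k) := by
    intro k N
    rw [Finset.sum_range_succ', Finset.sum_range_succ' _ N, attackProb_zero_succ, pow_zero,
      mul_one, mul_one, add_sub_cancel_right, Finset.mul_sum, Finset.mul_sum,
      ← Finset.sum_add_distrib]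
    simp only [attackProb_succ_succ ha ha']
    simp only [Complex.ofReal_zero, add_zero]
    refine Finset.sum_congr rfl fun r _ => ?_
    push_cast
    ring
  induction k generalizing N with
  | zero =>
    obtain ⟨N, rfl⟩ : ∃ n, N = n + 2 := ⟨N - 2, by omega⟩
    have h0 : ∀ n, ∑ r ∈ Finset.range (n + 1), (attackProb a r 0 : ℂ) * z ^ r = 1 := by
      intro n
      rw [Finset.sum_range_succ']
      simp [attackProb_succ_zero ha ha', attackProb_zero_zero]
    rw [hrec 0 (N + 1), h0, h0, attackProb_zero_zero]
    simp
  | succ k ih =>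
    obtain ⟨N, rfl⟩ : ∃ n, N = n + 1 := ⟨N - 1, by omega⟩
    rw [hrec (k + 1) N, ih N (by omega), ih (N + 1) (by omega), attackProb_zero_succ]
    push_cast
    ring

/-- The probability that `k` nodes are lost over a time interval of length `s`: the number of
attacks is Poisson with mean `λ s`. More than `k` attacks destroy more than `k` nodes, so that the
mixture is a finite sum. -/
noncomputable def nodeProb (lam a : ℝ) (k : ℕ) (s : ℝ) : ℝ :=
  ∑ r ∈ Finset.range (k + 1),
    Real.exp (-(lam * s)) * (lam * s) ^ r / (r.factorial : ℝ) * attackProb a r k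

lemma continuous_nodeProb (lam a : ℝ) (k : ℕ) : Continuous (nodeProb lam a k) := by
  unfold nodeProb
  fun_prop

lemma cexp_mul_nodeProb (lam a : ℝ) (k : ℕ) (θ : ℂ) (s : ℝ) :
    Complex.exp (-θ * s) * nodeProb lam a k s = ∑ r ∈ Finset.range (k + 1),
      (lam ^ r * attackProb a r k : ℂ)
        * ((s : ℂ) ^ r / (r.factorial : ℂ) * Complex.exp (-((lam + θ) * s))) := by
  have : Complex.exp (-((lam + θ) * s)) = Complex.exp (-θ * s) * Complex.exp (-(lam * s)) := by
    rw [← Complex.exp_add]; ring_nf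
  rw [nodeProb, this]
  push_cast
  rw [Finset.mul_sum]
  refine Finset.sum_congr rfl fun r _ => ?_
  rw [mul_pow]
  ring

lemma integrableOn_nodeProb {lam a : ℝ} (hlam : 0 < lam) (k : ℕ) {θ : ℂ} (hθ : 0 ≤ θ.re) :
    IntegrableOn (fun s : ℝ => Complex.exp (-θ * s) * nodeProb lam a k s) (Ici 0) := by
  simp only [cexp_mul_nodeProb]
  refine integrable_finsetSum _ fun r _ => Integrable.const_mul ?_ _
  rw [← IntegrableOn, integrableOn_Ici_iff_integrableOn_Ioi]
  exact integrableOn_monomial_mul_cexp r _ (by simp; linarith)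

lemma integral_nodeProb {lam a : ℝ} (hlam : 0 < lam) (ha : 0 < a) (ha' : a ≤ 1) (k : ℕ) {θ : ℂ}
    (hθ : 0 ≤ θ.re) :
    ∫ s : ℝ in Ici 0, Complex.exp (-θ * s) * nodeProb lam a k s = nodeLaplace lam a k θ := by
  have hθ0 := lam_add_ne_zero hlam hθ
  have hre : 0 < ((lam : ℂ) + θ).re := by simp; linarith
  simp only [cexp_mul_nodeProb]
  rw [integral_Ici_eq_integral_Ioi, integral_finsetSum]
  · simp only [integral_const_mul, integral_monomial_mul_cexp _ _ hre]
    have h1 : ∑ r ∈ Finset.range (k + 1), (lam ^ r * attackProb a r k : ℂ)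
          * (1 / (lam + θ) ^ (r + 1))
        = 1 / (lam + θ) * ∑ r ∈ Finset.range (k + 1),
          (attackProb a r k : ℂ) * (lam / (lam + θ)) ^ r := by
      rw [Finset.mul_sum]
      refine Finset.sum_congr rfl fun r _ => ?_
      rw [div_pow, pow_succ]
      field_simp
    rw [h1]
    cases k with
    | zero => simp [nodeLaplace, attackProb_zero_zero]
    | succ k =>
      rw [sum_attackProb_mul_pow ha ha' _ k _ le_rfl, nodeLaplace_succ, cFun]
      have h2 : (1 - (a : ℂ)) + a * (lam / (lam + θ)) = (lam + (1 - a) * θ) / (lam + θ) := by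
        field_simp
        ring
      rw [h2]
      field_simp
  · intro r _
    exact (integrableOn_monomial_mul_cexp r _ hre).const_mul _

lemma integral_nodeProb_expMeasure {lam mu a : ℝ} (hlam : 0 < lam) (hmu : 0 < mu) (ha : 0 < a)
    (ha' : a ≤ 1) (k : ℕ) {h : ℂ} (hh : 0 ≤ h.re) :
    ∫ s, Complex.exp (-h * (s : ℝ)) * nodeProb lam a k s ∂expMeasure mu
      = mu * nodeLaplace lam a k (mu + h) := by
  have := isProbabilityMeasure_expMeasure hmu
  have h1 : expMeasure mu = sumLaw (expMeasure mu) (0 + 1) := by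
    rw [sumLaw, sumLaw, Measure.dirac_zero_conv]
  rw [h1, integral_sumLaw_expMeasure_succ hmu, ← integral_nodeProb hlam ha ha' k
    (by simp; linarith), ← integral_const_mul]
  refine integral_congr_ae (ae_of_all _ fun s => ?_)
  have : Complex.exp (-(mu + h) * s) = Complex.exp (-(mu * s)) * Complex.exp (-h * s) := by
    rw [← Complex.exp_add]; ring_nf
  simp only
  rw [this]
  simp
  ring

/-- Summing over all observation epochs `τ_1, τ_2, …` turns the law of `τ_m` into `μ` times Lebesgue
measure. -/
lemma hasSum_integral_nodeProb_succ {lam mu a : ℝ} (hlam : 0 < lam) (hmu : 0 < mu) (ha : 0 < a)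
    (ha' : a ≤ 1) (k : ℕ) {h : ℂ} (hh : 0 ≤ h.re) :
    HasSum (fun m => ∫ s, Complex.exp (-h * (s : ℝ)) * nodeProb lam a k s
      ∂sumLaw (expMeasure mu) (m + 1)) (mu * nodeLaplace lam a k h) := by
  have hint : Integrable (fun s : ℝ => Complex.exp (-h * (s : ℝ)) * nodeProb lam a k s)
      (Measure.sum (fun m => sumLaw (expMeasure mu) (m + 1))) := by
    rw [sum_sumLaw_expMeasure hmu]
    exact (integrableOn_nodeProb hlam k hh).smul_measure ENNReal.ofReal_ne_top
  have h1 := hasSum_integral_measure hint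
  rwa [sum_sumLaw_expMeasure hmu, integral_smul_measure, integral_nodeProb hlam ha ha' _ hh,
    ENNReal.toReal_ofReal hmu.le, Complex.real_smul] at h1

/-- The epoch `τ_0 = 0` contributes nothing, as no node is lost at time `0`. -/
lemma hasSum_integral_nodeProb {lam mu a : ℝ} (hlam : 0 < lam) (hmu : 0 < mu) (ha : 0 < a)
    (ha' : a ≤ 1) (k : ℕ) {h : ℂ} (hh : 0 ≤ h.re) :
    HasSum (fun m => ∫ s, Complex.exp (-h * (s : ℝ)) * nodeProb lam a (k + 1) s
      ∂sumLaw (expMeasure mu) m) (mu * nodeLaplace lam a (k + 1) h) := by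
  have h0 : ∫ s, Complex.exp (-h * (s : ℝ)) * nodeProb lam a (k + 1) s
      ∂sumLaw (expMeasure mu) 0 = 0 := by
    rw [sumLaw, integral_dirac, nodeProb, Finset.sum_range_succ']
    simp [attackProb_zero_succ]
  refine (hasSum_nat_add_iff' 1).1 ?_
  rw [Finset.sum_range_one, h0, sub_zero]
  exact hasSum_integral_nodeProb_succ hlam hmu ha ha' (k + 1) hh

/-! ### Sums over random index sets -/

section Freezing

variable {Ω : Type*}

/-- Fubini for two independent random elements: one of them can be frozen. -/
lemma integral_eq_integral_integral_of_indepFun {mΩ : MeasurableSpace Ω} {P : Measure Ω}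
    [IsProbabilityMeasure P] {E F : Type*} [MeasurableSpace E] [MeasurableSpace F]
    {X : Ω → E} {Y : Ω → F} (hX : Measurable X) (hY : Measurable Y)
    (hXY : IndepFun X Y P) {f : E × F → ℂ} (hf : Measurable f)
    (hfi : Integrable (fun ω => f (X ω, Y ω)) P) :
    ∫ ω, f (X ω, Y ω) ∂P = ∫ ω, ∫ ω', f (X ω, Y ω') ∂P ∂P := by
  have hp := hXY.map_prod_eq_prod_map_map hX.aemeasurable hY.aemeasurable
  have := Measure.isProbabilityMeasure_map (μ := P) hX.aemeasurable
  have := Measure.isProbabilityMeasure_map (μ := P) hY.aemeasurable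
  have h1 : ∫ ω, f (X ω, Y ω) ∂P = ∫ p, f p ∂(P.map X).prod (P.map Y) := by
    rw [← hp, integral_map (hX.prodMk hY).aemeasurable hf.aestronglyMeasurable]
  have h2 : Integrable f ((P.map X).prod (P.map Y)) := by
    rw [← hp]
    exact (integrable_map_measure hf.aestronglyMeasurable (hX.prodMk hY).aemeasurable).2 hfi
  rw [h1, integral_prod _ h2, integral_map hX.aemeasurable]
  · refine integral_congr_ae (ae_of_all _ fun ω => ?_)
    exact integral_map hY.aemeasurable (hf.comp measurable_prodMk_left).aestronglyMeasurable
  · have : StronglyMeasurable (Function.uncurry fun x y => f (x, y)) := hf.stronglyMeasurable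
    exact this.integral_prod_right.aestronglyMeasurable

lemma indepFun_of_indep {m m' mΩ : MeasurableSpace Ω} {P : Measure Ω} {E F : Type*}
    [MeasurableSpace E] [MeasurableSpace F] (h : Indep m m' P)
    {X : Ω → E} {Y : Ω → F} (hX : Measurable[m] X)
    (hY : Measurable[m'] Y) : IndepFun X Y P :=
  (IndepFun_iff_Indep _ _ _).2 (indep_of_indep_of_le_left
    (indep_of_indep_of_le_right h hY.comap_le) hX.comap_le)

lemma measurable_iSup_comap {ι E : Type*} [MeasurableSpace E] (X : ι → Ω → E) :
    Measurable[⨆ i, MeasurableSpace.comap (X i) inferInstance] (fun ω i => X i ω) :=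
  @measurable_pi_lambda _ _ _ (_) _ _ fun i => Measurable.mono (comap_measurable (X i))
    (le_iSup (fun i => MeasurableSpace.comap (X i) inferInstance) i) le_rfl

/-- Let `w` be an iid family that is independent of the finite random index sets `F`, `F'` and of
`Z`. Given the latter, the sums of `w` over `F` and over `F'` are independent, and their laws are
the convolution powers of orders `|F|` and `|F'|`. -/
lemma integral_sum_random_index {m mΩ : MeasurableSpace Ω} {P : Measure Ω}
    [IsProbabilityMeasure P] {ι G : Type*} [Countable ι] [AddCommMonoid G] [MeasurableSpace G]
    [MeasurableAdd₂ G] {ν : Measure G} {w : ι → Ω → G} (hw : ∀ i, Measurable (w i))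
    (hlaw : ∀ i, P.map (w i) = ν) (hind : iIndepFun w P) (hm : m ≤ mΩ)
    (hmw : Indep m (⨆ i, MeasurableSpace.comap (w i) inferInstance) P)
    {F F' : Ω → Finset ι} (hF : Measurable[m] F) (hF' : Measurable[m] F')
    (hFF' : ∀ ω, Disjoint (F ω) (F' ω)) {Z : Ω → ℂ} (hZ : Measurable[m] Z)
    (hZ1 : ∀ᵐ ω ∂P, ‖Z ω‖ ≤ 1)
    {φ : G × G → ℂ} (hφ : Measurable φ)
    (hφ1 : ∀ᵐ ω ∂P, ‖φ (∑ i ∈ F ω, w i ω, ∑ i ∈ F' ω, w i ω)‖ ≤ 1) :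
    ∫ ω, Z ω * φ (∑ i ∈ F ω, w i ω, ∑ i ∈ F' ω, w i ω) ∂P
      = ∫ ω, Z ω * ∫ x, φ x ∂(sumLaw ν (F ω).card).prod (sumLaw ν (F' ω).card) ∂P := by
  have hX : Measurable[m] fun ω => ((F ω, F' ω), Z ω) := (hF.prodMk hF').prodMk hZ
  have hY := measurable_iSup_comap w
  have hY' : Measurable fun ω i => w i ω := measurable_pi_lambda _ hw
  have hS : Measurable fun p : (Finset ι × Finset ι) × (ι → G) =>
      (∑ i ∈ p.1.1, p.2 i, ∑ i ∈ p.1.2, p.2 i) := by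
    refine measurable_from_prod_countable_right fun A => ?_
    exact (Finset.measurable_fun_sum A.1 fun i _ => measurable_pi_apply i).prodMk
      (Finset.measurable_fun_sum A.2 fun i _ => measurable_pi_apply i)
  have hf : Measurable fun p : ((Finset ι × Finset ι) × ℂ) × (ι → G) =>
      p.1.2 * φ (∑ i ∈ p.1.1.1, p.2 i, ∑ i ∈ p.1.1.2, p.2 i) := by
    refine (measurable_snd.comp measurable_fst).mul (hφ.comp ?_)
    exact hS.comp ((measurable_fst.comp measurable_fst).prodMk measurable_snd)
  have hX' := hX.mono hm le_rfl
  have hint : Integrable (fun ω => Z ω * φ (∑ i ∈ F ω, w i ω, ∑ i ∈ F' ω, w i ω)) P := by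
    refine Integrable.of_bound (hf.comp (hX'.prodMk hY')).aestronglyMeasurable 1 ?_
    filter_upwards [hZ1, hφ1] with ω h1 h2
    rw [norm_mul]
    exact mul_le_one₀ h1 (norm_nonneg _) h2
  rw [integral_eq_integral_integral_of_indepFun hX' hY' (indepFun_of_indep hmw hX hY) hf hint]
  refine integral_congr_ae (ae_of_all _ fun ω => ?_)
  simp only
  rw [integral_const_mul, ← map_sum_prod_sum hw hlaw hind _ _ (hFF' ω), integral_map]
  · exact ((Finset.measurable_fun_sum _ fun i _ => hw i).prodMk
      (Finset.measurable_fun_sum _ fun i _ => hw i)).aemeasurable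
  · exact hφ.aestronglyMeasurable

end Freezing

/-! ### Counting the attacks -/

/-- The elements of an index set, if there are finitely many, and the empty set otherwise. -/
noncomputable def finIndex (s : Set ℕ) : Finset ℕ :=
  open Classical in if h : s.Finite then h.toFinset else ∅

lemma mem_finIndex {s : Set ℕ} {k : ℕ} : k ∈ finIndex s ↔ s.Finite ∧ k ∈ s := by
  rw [finIndex]
  split_ifs with h <;> simp [h]

lemma measurable_finIndex : Measurable finIndex := by
  refine measurable_finset_iff.2 fun k => ?_
  simp only [mem_finIndex]
  exact measurableSet_setOfPred.1 (MeasurableSet.setOfPred_finite.inter (measurableSet_mem k))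

lemma card_finIndex {s : Set ℕ} (hs : s.Finite) : ((finIndex s).card : ℕ∞) = s.encard := by
  rw [finIndex, dif_pos hs, hs.encard_eq_coe_toFinset_card]

section Count

variable {Ω : Type*} [mΩ : MeasurableSpace Ω] {P : Measure Ω} [IsProbabilityMeasure P]
  {lam mu a ξ : ℝ} {t : ℕ → Ω → ℝ}

/-- The probability that the attacks of a finite number `c` destroy `k` nodes, as a function of
`c : ℕ∞`; more than `k` attacks cannot. -/
noncomputable def countProb (a : ℝ) (k : ℕ) (c : ℕ∞) : ℂ :=
  ∑ r ∈ Finset.range (k + 1), (attackProb a r k : ℂ) * ({(r : ℕ∞)} : Set ℕ∞).indicator 1 c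

lemma countProb_coe (ha : 0 < a) (ha' : a ≤ 1) (k r : ℕ) :
    countProb a k (r : ℕ∞) = attackProb a r k := by
  rw [countProb]
  by_cases hr : r ∈ Finset.range (k + 1)
  · rw [Finset.sum_eq_single_of_mem r hr]
    · simp
    · intro b _ hb
      simp [hb.symm]
  · rw [attackProb_of_lt ha ha' (by simpa using hr), Complex.ofReal_zero]
    refine Finset.sum_eq_zero fun b hb => ?_
    have : r ≠ b := by rintro rfl; exact hr hb
    simp [this]

lemma measurable_countProb (a : ℝ) (k : ℕ) : Measurable (countProb a k) :=
  measurable_from_top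

lemma measurable_attackCount (ht : ∀ k, Measurable (t k)) {B : Set ℝ} (hB : MeasurableSet B) :
    Measurable (attackCount t B) := by
  refine measurable_encard.comp (measurable_set_iff.2 fun k => ?_)
  exact measurableSet_setOfPred.1 (ht k hB)

lemma ae_finite_attacks_mem (hlam : 0 < lam) (ht : IsPoissonProcess P lam t) {B : Set ℝ}
    (hB : MeasurableSet B) (hB0 : B ⊆ Ici 0) (hBv : volume B ≠ ⊤) :
    ∀ᵐ ω ∂P, {k : ℕ | t k ω ∈ B}.Finite := by
  have hm := measurable_attackCount ht.measurable hB
  set x := lam * (volume B).toReal with hx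
  have hx0 : 0 ≤ x := by positivity
  have hsum : ∑' j : ℕ, P {ω | attackCount t B ω = (j : ℕ∞)} = 1 := by
    simp only [ht.law B hB hB0 hBv, ← hx]
    have h1 : HasSum (fun j : ℕ => Real.exp (-x) * x ^ j / (j.factorial : ℝ)) 1 := by
      have h2 := (NormedSpace.expSeries_div_hasSum_exp x).mul_left (Real.exp (-x))
      rw [← Real.exp_eq_exp_ℝ, ← Real.exp_add, neg_add_cancel, Real.exp_zero] at h2
      simpa only [mul_div_assoc] using h2
    rw [← ENNReal.ofReal_tsum_of_nonneg (fun j => by positivity) h1.summable, h1.tsum_eq,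
      ENNReal.ofReal_one]
  rw [← measure_iUnion] at hsum
  · have h2 : ∀ᵐ ω ∂P, ω ∈ ⋃ j : ℕ, {ω | attackCount t B ω = (j : ℕ∞)} := by
      rw [← prob_compl_eq_zero_iff] at hsum
      · exact hsum
      · exact MeasurableSet.iUnion fun j => hm (measurableSet_singleton _)
    filter_upwards [h2] with ω hω
    obtain ⟨j, hj⟩ := mem_iUnion.1 hω
    exact finite_of_encard_eq_coe hj
  · intro i j hij
    refine Set.disjoint_left.2 fun ω h1 h2 => hij ?_
    have : (i : ℕ∞) = j := h1.symm.trans h2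
    exact_mod_cast this
  · exact fun j => hm (measurableSet_singleton _)

/-- Almost surely every bounded time interval contains finitely many attacks. -/
lemma ae_finite_attacks (hlam : 0 < lam) (ht : IsPoissonProcess P lam t) :
    ∀ᵐ ω ∂P, ∀ x : ℝ, {k : ℕ | t k ω ∈ Icc 0 x}.Finite := by
  have h : ∀ᵐ ω ∂P, ∀ n : ℕ, {k : ℕ | t k ω ∈ Icc 0 (n : ℝ)}.Finite :=
    ae_all_iff.2 fun n => ae_finite_attacks_mem hlam ht measurableSet_Icc
      (fun x hx => hx.1) (by simp)
  filter_upwards [h] with ω hω x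
  obtain ⟨n, hn⟩ := exists_nat_ge x
  exact (hω n).subset fun k hk => ⟨hk.1, hk.2.trans hn⟩

lemma integral_countProb (hlam : 0 < lam) (ht : IsPoissonProcess P lam t) {B : Set ℝ}
    (hB : MeasurableSet B) (hB0 : B ⊆ Ici 0) (hBv : volume B ≠ ⊤) (k : ℕ) :
    ∫ ω, countProb a k (attackCount t B ω) ∂P = nodeProb lam a k (volume B).toReal := by
  have hm := measurable_attackCount ht.measurable hB
  have hms : ∀ r : ℕ, MeasurableSet {ω | attackCount t B ω = (r : ℕ∞)} :=
    fun r => hm (measurableSet_singleton _)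
  have hi : ∀ r : ℕ, (fun ω => ({(r : ℕ∞)} : Set ℕ∞).indicator (1 : ℕ∞ → ℂ) (attackCount t B ω))
      = {ω | attackCount t B ω = (r : ℕ∞)}.indicator fun _ => 1 := by
    intro r
    funext ω
    simp [indicator_apply]
  simp only [countProb, nodeProb]
  rw [integral_finsetSum]
  · push_cast
    refine Finset.sum_congr rfl fun r _ => ?_
    rw [integral_const_mul, hi, integral_indicator_const (1 : ℂ) (hms r),
      measureReal_def, ht.law B hB hB0 hBv, ENNReal.toReal_ofReal (by positivity)]
    rw [Complex.real_smul]
    push_cast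
    ring
  · intro r _
    refine Integrable.const_mul ?_ _
    rw [hi]
    exact (integrable_const 1).indicator (hms r)

lemma norm_countProb_le (ha : 0 < a) (ha' : a ≤ 1) (k : ℕ) (c : ℕ∞) : ‖countProb a k c‖ ≤ 1 := by
  have := isProbabilityMeasure_geomLaw ha ha'
  induction c using ENat.recTopCoe with
  | top => simp [countProb]
  | coe r =>
    rw [countProb_coe ha ha', Complex.norm_real, attackProb, Real.norm_of_nonneg measureReal_nonneg]
    exact measureReal_le_one

/-- The node losses over the adjacent intervals `[0, x]` and `(x, x + y]` are independent. -/
lemma integral_countProb_mul (hlam : 0 < lam) (ht : IsPoissonProcess P lam t) {x y : ℝ}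
    (hx : 0 ≤ x) (hy : 0 ≤ y) (k j : ℕ) :
    ∫ ω, countProb a k (attackCount t (Icc 0 x) ω)
        * countProb a j (attackCount t (Ioc x (x + y)) ω) ∂P
      = nodeProb lam a k x * nodeProb lam a j y := by
  have hind := ht.indep 2 ![Icc 0 x, Ioc x (x + y)]
    (by simp [Fin.forall_fin_two])
    (by simp only [Fin.forall_fin_two]; exact ⟨fun z hz => hz.1, fun z hz => hx.trans hz.1.le⟩)
    (by simp [Fin.forall_fin_two])
    (by
      have hd : Disjoint (Icc 0 x) (Ioc x (x + y)) :=
        Set.disjoint_left.2 fun z h1 h2 => absurd h1.2 (not_le.2 h2.1)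
      intro i j hij
      fin_cases i <;> fin_cases j <;> simp_all [hd.symm])
  have h01 := (hind.indepFun (i := 0) (j := 1) (by simp)).comp (measurable_countProb a k)
    (measurable_countProb a j)
  have hm1 := measurable_attackCount ht.measurable (B := Icc 0 x) measurableSet_Icc
  have hm2 := measurable_attackCount ht.measurable (B := Ioc x (x + y)) measurableSet_Ioc
  have h := h01.integral_mul_eq_mul_integral
    ((measurable_countProb a k).comp hm1).aestronglyMeasurable
    ((measurable_countProb a j).comp hm2).aestronglyMeasurable
  have e1 := integral_countProb (a := a) hlam ht (B := Icc 0 x) measurableSet_Icc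
    (fun z hz => hz.1) (by simp) k
  have e2 := integral_countProb (a := a) hlam ht (B := Ioc x (x + y)) measurableSet_Ioc
    (fun z hz => hx.trans hz.1.le) (by simp) j
  simp only [Real.volume_Icc, Real.volume_Ioc, sub_zero, add_sub_cancel_left,
    ENNReal.toReal_ofReal hx, ENNReal.toReal_ofReal hy] at e1 e2
  rw [← e1, ← e2]
  exact h

end Count

/-! ### The attacks seen by the observer -/

section Outcome

variable {Ω : Type*} {t : ℕ → Ω → ℝ} {n : ℕ → Ω → ℕ} {w : ℕ → ℕ → Ω → ℝ} {Δ : ℕ → Ω → ℝ}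

/-- The indices of the attacks in `[0, τ_m]`. -/
noncomputable def pastAttacks (t : ℕ → Ω → ℝ) (Δ : ℕ → Ω → ℝ) (m : ℕ) (ω : Ω) : Finset ℕ :=
  finIndex {k | t k ω ∈ Icc 0 (obsTime Δ m ω)}

/-- The indices of the attacks in `(τ_m, τ_{m+1}]`. -/
noncomputable def nextAttacks (t : ℕ → Ω → ℝ) (Δ : ℕ → Ω → ℝ) (m : ℕ) (ω : Ω) : Finset ℕ :=
  finIndex {k | t k ω ∈ Ioc (obsTime Δ m ω) (obsTime Δ (m + 1) ω)}

/-- The nodes lost in the attacks of a given finite index set: the `j`-th node of the `k`-th attack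
is the pair `(k, j)`. -/
def lostNodes (n : ℕ → Ω → ℕ) (K : Finset ℕ) (ω : Ω) : Finset (Σ _ : ℕ, ℕ) :=
  K.sigma fun k => Finset.range (n k ω)

lemma card_lostNodes (K : Finset ℕ) (ω : Ω) : (lostNodes n K ω).card = ∑ k ∈ K, n k ω := by
  simp [lostNodes]

lemma sum_lostNodes (K : Finset ℕ) (ω : Ω) (g : ℕ → ℕ → ℝ) :
    ∑ p ∈ lostNodes n K ω, g p.1 p.2 = ∑ k ∈ K, ∑ j ∈ Finset.range (n k ω), g k j := by
  rw [lostNodes, Finset.sum_sigma]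

/-- The outcomes for which the model behaves as intended: every bounded time interval contains
finitely many attacks, and no inter-observation time and no weight is negative. -/
structure IsRegularOutcome (t : ℕ → Ω → ℝ) (w : ℕ → ℕ → Ω → ℝ) (Δ : ℕ → Ω → ℝ) (ω : Ω) :
    Prop where
  finite : ∀ x : ℝ, {k : ℕ | t k ω ∈ Icc 0 x}.Finite
  obs_nonneg : ∀ i, 0 ≤ Δ i ω
  weight_nonneg : ∀ k j, 0 ≤ w k j ω

lemma obsTime_succ (m : ℕ) (ω : Ω) : obsTime Δ (m + 1) ω = obsTime Δ m ω + Δ m ω := by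
  rw [obsTime, Finset.sum_range_succ, ← obsTime]

lemma disjoint_pastAttacks_nextAttacks (m : ℕ) (ω : Ω) :
    Disjoint (pastAttacks t Δ m ω) (nextAttacks t Δ m ω) := by
  refine Finset.disjoint_left.2 fun k h1 h2 => ?_
  rw [pastAttacks, mem_finIndex] at h1
  rw [nextAttacks, mem_finIndex] at h2
  exact absurd h1.2.2 (not_le.2 h2.2.1)

lemma disjoint_lostNodes {K K' : Finset ℕ} (h : Disjoint K K') (ω : Ω) :
    Disjoint (lostNodes n K ω) (lostNodes n K' ω) := by
  refine Finset.disjoint_left.2 fun p h1 h2 => ?_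
  exact Finset.disjoint_left.1 h (Finset.mem_sigma.1 h1).1 (Finset.mem_sigma.1 h2).1

lemma tsum_indicator_eq_sum_finIndex {A : Type*} [AddCommMonoid A] [TopologicalSpace A] [T2Space A]
    {s : Set ℕ} (hs : s.Finite) (f : ℕ → A) : ∑' k, s.indicator f k = ∑ k ∈ finIndex s, f k := by
  rw [tsum_eq_sum (s := finIndex s)]
  · exact Finset.sum_congr rfl fun k hk => indicator_of_mem (mem_finIndex.1 hk).2 f
  · intro k hk
    exact indicator_of_notMem (fun h => hk (mem_finIndex.2 ⟨hs, h⟩)) f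

namespace IsRegularOutcome

variable {ω : Ω}

lemma obsTime_nonneg (hω : IsRegularOutcome t w Δ ω) (m : ℕ) : 0 ≤ obsTime Δ m ω :=
  Finset.sum_nonneg fun i _ => hω.obs_nonneg i

lemma finite_next (hω : IsRegularOutcome t w Δ ω) (m : ℕ) :
    {k | t k ω ∈ Ioc (obsTime Δ m ω) (obsTime Δ (m + 1) ω)}.Finite :=
  (hω.finite (obsTime Δ (m + 1) ω)).subset fun _ hk => ⟨(hω.obsTime_nonneg m).trans hk.1.le, hk.2⟩

lemma tsum_next (hω : IsRegularOutcome t w Δ ω) {A : Type*} [AddCommMonoid A] [TopologicalSpace A]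
    [T2Space A] (m : ℕ) (f : ℕ → A) :
    ∑' k, {k | t k ω ∈ obsWindow Δ (m + 1) ω}.indicator f k = ∑ k ∈ nextAttacks t Δ m ω, f k :=
  tsum_indicator_eq_sum_finIndex (hω.finite_next m) f

lemma mem_pastAttacks (hω : IsRegularOutcome t w Δ ω) {m k : ℕ} :
    k ∈ pastAttacks t Δ m ω ↔ 0 ≤ t k ω ∧ t k ω ≤ obsTime Δ m ω :=
  mem_finIndex.trans (and_iff_right (hω.finite _))

lemma mem_nextAttacks (hω : IsRegularOutcome t w Δ ω) {m k : ℕ} :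
    k ∈ nextAttacks t Δ m ω ↔ obsTime Δ m ω < t k ω ∧ t k ω ≤ obsTime Δ (m + 1) ω :=
  mem_finIndex.trans (and_iff_right (hω.finite_next m))

lemma pastAttacks_succ (hω : IsRegularOutcome t w Δ ω) (m : ℕ) :
    pastAttacks t Δ (m + 1) ω
      = (pastAttacks t Δ m ω).disjUnion (nextAttacks t Δ m ω)
        (disjoint_pastAttacks_nextAttacks m ω) := by
  ext k
  have h0 := hω.obsTime_nonneg m
  have h1 := hω.obs_nonneg m
  rw [Finset.mem_disjUnion, hω.mem_pastAttacks, hω.mem_pastAttacks, hω.mem_nextAttacks,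
    obsTime_succ]
  constructor
  · rintro ⟨h2, h3⟩
    rcases le_or_gt (t k ω) (obsTime Δ m ω) with h4 | h4
    · exact Or.inl ⟨h2, h4⟩
    · exact Or.inr ⟨h4, h3⟩
  · rintro (⟨h2, h3⟩ | ⟨h2, h3⟩)
    · exact ⟨h2, by linarith⟩
    · exact ⟨by linarith, h3⟩

lemma sum_tsum_window (hω : IsRegularOutcome t w Δ ω) {A : Type*} [AddCommMonoid A]
    [TopologicalSpace A] [T2Space A] (m : ℕ) (f : ℕ → A) :
    ∑ i ∈ Finset.range (m + 1), ∑' k, {k | t k ω ∈ obsWindow Δ i ω}.indicator f k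
      = ∑ k ∈ pastAttacks t Δ m ω, f k := by
  induction m with
  | zero =>
    rw [Finset.sum_range_one]
    exact tsum_indicator_eq_sum_finIndex (hω.finite (obsTime Δ 0 ω)) f
  | succ m ih =>
    rw [Finset.sum_range_succ, ih, hω.pastAttacks_succ, Finset.sum_disjUnion, hω.tsum_next]

lemma cumNodes_eq (hω : IsRegularOutcome t w Δ ω) (m : ℕ) :
    cumNodes t n Δ m ω = ∑ k ∈ pastAttacks t Δ m ω, n k ω :=
  hω.sum_tsum_window m fun k => n k ω

lemma nodeLoss_eq (hω : IsRegularOutcome t w Δ ω) (m : ℕ) :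
    nodeLoss t n (obsWindow Δ (m + 1) ω) ω = ∑ k ∈ nextAttacks t Δ m ω, n k ω :=
  hω.tsum_next m fun k => n k ω

lemma cumWeight_eq (hω : IsRegularOutcome t w Δ ω) (m : ℕ) :
    cumWeight t n w Δ m ω = ∑ p ∈ lostNodes n (pastAttacks t Δ m ω) ω, w p.1 p.2 ω :=
  (hω.sum_tsum_window m _).trans (sum_lostNodes _ _ fun k j => w k j ω).symm

lemma weightLoss_eq (hω : IsRegularOutcome t w Δ ω) (m : ℕ) :
    weightLoss t n w (obsWindow Δ (m + 1) ω) ω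
      = ∑ p ∈ lostNodes n (nextAttacks t Δ m ω) ω, w p.1 p.2 ω :=
  (hω.tsum_next m _).trans (sum_lostNodes _ _ fun k j => w k j ω).symm

lemma weightLoss_nonneg (hω : IsRegularOutcome t w Δ ω) (B : Set ℝ) :
    0 ≤ weightLoss t n w B ω :=
  tsum_nonneg fun _ => indicator_nonneg
    (fun _ _ => Finset.sum_nonneg fun _ _ => hω.weight_nonneg _ _) _

lemma monotone_cumWeight (hω : IsRegularOutcome t w Δ ω) :
    Monotone fun m => cumWeight t n w Δ m ω :=
  monotone_nat_of_le_succ fun m => by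
    rw [cumWeight, cumWeight, Finset.sum_range_succ _ (m + 1)]
    exact le_add_of_nonneg_right (hω.weightLoss_nonneg _)

end IsRegularOutcome

lemma cumNodes_succ (m : ℕ) (ω : Ω) :
    cumNodes t n Δ (m + 1) ω
      = cumNodes t n Δ m ω + nodeLoss t n (obsWindow Δ (m + 1) ω) ω := by
  rw [cumNodes, Finset.sum_range_succ, ← cumNodes]

lemma cumWeight_succ (m : ℕ) (ω : Ω) :
    cumWeight t n w Δ (m + 1) ω
      = cumWeight t n w Δ m ω + weightLoss t n w (obsWindow Δ (m + 1) ω) ω := by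
  rw [cumWeight, Finset.sum_range_succ, ← cumWeight]

lemma monotone_cumNodes (ω : Ω) : Monotone fun m => cumNodes t n Δ m ω :=
  monotone_nat_of_le_succ fun m => by
    rw [cumNodes_succ]
    exact Nat.le_add_right _ _

end Outcome

section Measurability

variable {Ω : Type*} {mΩ : MeasurableSpace Ω} {t : ℕ → Ω → ℝ} {n : ℕ → Ω → ℕ} {Δ : ℕ → Ω → ℝ}

lemma measurable_obsTime (hΔ : ∀ i, Measurable (Δ i)) (m : ℕ) : Measurable (obsTime Δ m) :=
  Finset.measurable_fun_sum _ fun i _ => hΔ i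

lemma measurable_cexp_obsTime (hΔ : ∀ i, Measurable (Δ i)) (h : ℂ) (m : ℕ) :
    Measurable fun ω => Complex.exp (-h * obsTime Δ m ω) := by
  have := measurable_obsTime hΔ m
  fun_prop

lemma measurable_pastAttacks (ht : ∀ k, Measurable (t k)) (hΔ : ∀ i, Measurable (Δ i)) (m : ℕ) :
    Measurable (pastAttacks t Δ m) := by
  refine measurable_finIndex.comp (measurable_set_iff.2 fun k => measurableSet_setOfPred.1 ?_)
  exact (measurableSet_le measurable_const (ht k)).inter
    (measurableSet_le (ht k) (measurable_obsTime hΔ m))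

lemma measurable_nextAttacks (ht : ∀ k, Measurable (t k)) (hΔ : ∀ i, Measurable (Δ i)) (m : ℕ) :
    Measurable (nextAttacks t Δ m) := by
  refine measurable_finIndex.comp (measurable_set_iff.2 fun k => measurableSet_setOfPred.1 ?_)
  exact (measurableSet_lt (measurable_obsTime hΔ m) (ht k)).inter
    (measurableSet_le (ht k) (measurable_obsTime hΔ (m + 1)))

lemma measurable_lostNodes (hn : ∀ k, Measurable (n k)) {K : Ω → Finset ℕ} (hK : Measurable K) :
    Measurable fun ω => lostNodes n (K ω) ω := by
  refine measurable_finset_iff.2 fun p => measurableSet_setOfPred.1 ?_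
  simp only [lostNodes, Finset.mem_sigma, Finset.mem_range]
  exact (measurableSet_setOfPred.2 (measurable_finset_iff.1 hK p.1)).inter
    (measurableSet_lt measurable_const (hn p.1))

lemma measurable_sum_nodes (hn : ∀ k, Measurable (n k)) {K : Ω → Finset ℕ} (hK : Measurable K) :
    Measurable fun ω => ∑ k ∈ K ω, n k ω := by
  have h : Measurable fun p : Finset ℕ × Ω => ∑ k ∈ p.1, n k p.2 :=
    measurable_from_prod_countable_right fun A => Finset.measurable_fun_sum A fun k _ => hn k
  exact h.comp (hK.prodMk measurable_id)

lemma measurable_sum_weights {w : ℕ → ℕ → Ω → ℝ} (hw : ∀ k j, Measurable (w k j))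
    {F : Ω → Finset (Σ _ : ℕ, ℕ)} (hF : Measurable F) :
    Measurable fun ω => ∑ p ∈ F ω, w p.1 p.2 ω := by
  have h : Measurable fun p : Finset (Σ _ : ℕ, ℕ) × Ω => ∑ q ∈ p.1, w q.1 q.2 p.2 :=
    measurable_from_prod_countable_right fun A => Finset.measurable_fun_sum A fun q _ => hw q.1 q.2
  exact h.comp (hF.prodMk measurable_id)

lemma measurable_indicator_nodes (ht : ∀ k, Measurable (t k)) (hn : ∀ k, Measurable (n k))
    (hΔ : ∀ i, Measurable (Δ i)) (m k j : ℕ) :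
    Measurable fun ω => ({(k, j)} : Set (ℕ × ℕ)).indicator (1 : ℕ × ℕ → ℂ)
      (∑ i ∈ pastAttacks t Δ m ω, n i ω, ∑ i ∈ nextAttacks t Δ m ω, n i ω) :=
  (Measurable.of_discrete (f := ({(k, j)} : Set (ℕ × ℕ)).indicator (1 : ℕ × ℕ → ℂ))).comp
    ((measurable_sum_nodes hn (measurable_pastAttacks ht hΔ m)).prodMk
    (measurable_sum_nodes hn (measurable_nextAttacks ht hΔ m)))

end Measurability

/-! ### The joint law at two consecutive observations -/

section JointLaw

variable {Ω : Type*} {mΩ : MeasurableSpace Ω} {P : Measure Ω}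
  {lam mu a ξ : ℝ} {t : ℕ → Ω → ℝ} {n : ℕ → Ω → ℕ} {w : ℕ → ℕ → Ω → ℝ} {Δ : ℕ → Ω → ℝ}

/-- The σ-algebra generated by a family of random variables. -/
abbrev generatedBy {ι E Ω : Type*} [MeasurableSpace E] (X : ι → Ω → E) : MeasurableSpace Ω :=
  ⨆ i, MeasurableSpace.comap (X i) inferInstance

lemma measurable_generatedBy {ι E Ω : Type*} [MeasurableSpace E] (X : ι → Ω → E) (i : ι) :
    Measurable[generatedBy X] (X i) :=
  Measurable.mono (comap_measurable (X i))
    (le_iSup (fun i => MeasurableSpace.comap (X i) inferInstance) i) le_rfl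

namespace IsExponentialModel

lemma family_le (hmodel : IsExponentialModel P lam mu a ξ t n w Δ) (i : Fin 4) :
    (![⨆ k, MeasurableSpace.comap (t k) inferInstance,
      ⨆ k, MeasurableSpace.comap (n k) inferInstance,
      ⨆ k, ⨆ j, MeasurableSpace.comap (w k j) inferInstance,
      ⨆ i, MeasurableSpace.comap (Δ i) inferInstance] : Fin 4 → MeasurableSpace Ω) i ≤ mΩ := by
  fin_cases i
  · exact iSup_le fun k => (hmodel.attacks.measurable k).comap_le
  · exact iSup_le fun k => (hmodel.measurable_nodes k).comap_le
  · exact iSup_le fun k => iSup_le fun j => (hmodel.measurable_weight k j).comap_le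
  · exact iSup_le fun k => (hmodel.measurable_obs k).comap_le

lemma indep_weights (hmodel : IsExponentialModel P lam mu a ξ t n w Δ) :
    Indep (generatedBy t ⊔ generatedBy n ⊔ generatedBy Δ)
      (generatedBy fun p : Σ _ : ℕ, ℕ => w p.1 p.2) P := by
  have h := indep_iSup_of_disjoint hmodel.family_le hmodel.indep (S := {0, 1, 3}) (T := {2})
    (by simp)
  refine indep_of_indep_of_le_left (indep_of_indep_of_le_right h ?_) ?_
  · refine le_trans ?_ (le_iSup₂ (2 : Fin 4) (by simp))
    exact iSup_le fun p => le_iSup₂ (f := fun k j => MeasurableSpace.comap (w k j) inferInstance)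
      p.1 p.2
  · exact sup_le (sup_le (le_iSup₂_of_le (0 : Fin 4) (by simp) le_rfl)
      (le_iSup₂_of_le (1 : Fin 4) (by simp) le_rfl)) (le_iSup₂_of_le (3 : Fin 4) (by simp) le_rfl)

lemma indep_nodes (hmodel : IsExponentialModel P lam mu a ξ t n w Δ) :
    Indep (generatedBy t ⊔ generatedBy Δ) (generatedBy n) P := by
  have h := indep_iSup_of_disjoint hmodel.family_le hmodel.indep (S := {0, 3}) (T := {1})
    (by simp)
  refine indep_of_indep_of_le_left (indep_of_indep_of_le_right h ?_) ?_
  · exact le_iSup₂_of_le (1 : Fin 4) (by simp) le_rfl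
  · exact sup_le (le_iSup₂_of_le (0 : Fin 4) (by simp) le_rfl)
      (le_iSup₂_of_le (3 : Fin 4) (by simp) le_rfl)

lemma indep_obs (hmodel : IsExponentialModel P lam mu a ξ t n w Δ) :
    Indep (generatedBy Δ) (generatedBy t) P := by
  have h := indep_iSup_of_disjoint hmodel.family_le hmodel.indep (S := {3}) (T := {0})
    (by simp)
  refine indep_of_indep_of_le_left (indep_of_indep_of_le_right h ?_) ?_
  · exact le_iSup₂_of_le (0 : Fin 4) (by simp) le_rfl
  · exact le_iSup₂_of_le (3 : Fin 4) (by simp) le_rfl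

variable [IsProbabilityMeasure P]

lemma ae_isRegularOutcome (hmodel : IsExponentialModel P lam mu a ξ t n w Δ) (hlam : 0 < lam) :
    ∀ᵐ ω ∂P, IsRegularOutcome t w Δ ω := by
  have h1 : ∀ᵐ ω ∂P, ∀ i, 0 ≤ Δ i ω := ae_all_iff.2 fun i => by
    have := ae_nonneg_expMeasure mu
    rw [← hmodel.obs_law i] at this
    exact ae_of_ae_map (hmodel.measurable_obs i).aemeasurable this
  have h2 : ∀ᵐ ω ∂P, ∀ k j, 0 ≤ w k j ω := ae_all_iff.2 fun k => ae_all_iff.2 fun j => by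
    have := ae_nonneg_expMeasure ξ
    rw [← hmodel.weight_law k j] at this
    exact ae_of_ae_map (hmodel.measurable_weight k j).aemeasurable this
  filter_upwards [ae_finite_attacks hlam hmodel.attacks, h1, h2] with ω a1 a2 a3
  exact ⟨a1, a2, a3⟩

lemma map_nodes (hmodel : IsExponentialModel P lam mu a ξ t n w Δ) (ha : 0 < a) (ha' : a ≤ 1)
    (k : ℕ) : P.map (n k) = geomLaw a := by
  have := Measure.isProbabilityMeasure_map (μ := P) (hmodel.measurable_nodes k).aemeasurable
  refine eq_geomLaw ha ha' _ fun i => ?_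
  rw [Measure.map_apply (hmodel.measurable_nodes k) (measurableSet_singleton _)]
  exact hmodel.nodes_law k i

/-- The law of the numbers of attacks up to `τ_m` and between `τ_m` and `τ_{m+1}`, mixed with the
numbers of nodes they destroy. -/
lemma integral_countProb_attacks (hmodel : IsExponentialModel P lam mu a ξ t n w Δ)
    (hlam : 0 < lam) (hmu : 0 < mu) (ha : 0 < a) (ha' : a ≤ 1) (m k j : ℕ) {h : ℂ}
    (hh : 0 ≤ h.re) :
    ∫ ω, Complex.exp (-h * obsTime Δ (m + 1) ω)
        * (countProb a k (pastAttacks t Δ m ω).card * countProb a j (nextAttacks t Δ m ω).card) ∂P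
      = (∫ s, Complex.exp (-h * (s : ℝ)) * nodeProb lam a k s ∂sumLaw (expMeasure mu) m)
        * (mu * nodeLaplace lam a j (mu + h)) := by
  have hreg := hmodel.ae_isRegularOutcome hlam
  have hprob := isProbabilityMeasure_expMeasure hmu
  set f : (ℝ × ℝ) × (ℕ → ℝ) → ℂ := fun p => Complex.exp (-h * (p.1.1 + p.1.2 : ℝ))
    * (countProb a k {i | p.2 i ∈ Icc 0 p.1.1}.encard
      * countProb a j {i | p.2 i ∈ Ioc p.1.1 (p.1.1 + p.1.2)}.encard) with hf
  have hfm : Measurable f := by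
    have e1 : Measurable fun p : (ℝ × ℝ) × (ℕ → ℝ) => p.1.1 := by fun_prop
    have e2 : Measurable fun p : (ℝ × ℝ) × (ℕ → ℝ) => p.1.1 + p.1.2 := by fun_prop
    have e3 : ∀ i, Measurable fun p : (ℝ × ℝ) × (ℕ → ℝ) => p.2 i := by fun_prop
    have h1 : Measurable fun p : (ℝ × ℝ) × (ℕ → ℝ) => {i | p.2 i ∈ Icc 0 p.1.1} := by
      refine measurable_set_iff.2 fun i => measurableSet_setOfPred.1 ?_
      exact (measurableSet_le measurable_const (e3 i)).inter (measurableSet_le (e3 i) e1)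
    have h2 : Measurable fun p : (ℝ × ℝ) × (ℕ → ℝ) =>
        {i | p.2 i ∈ Ioc p.1.1 (p.1.1 + p.1.2)} := by
      refine measurable_set_iff.2 fun i => measurableSet_setOfPred.1 ?_
      exact (measurableSet_lt e1 (e3 i)).inter (measurableSet_le (e3 i) e2)
    exact (by fun_prop : Measurable fun p : (ℝ × ℝ) × (ℕ → ℝ) =>
      Complex.exp (-h * (p.1.1 + p.1.2 : ℝ))).mul
      (((measurable_countProb a k).comp (measurable_encard.comp h1)).mul
        ((measurable_countProb a j).comp (measurable_encard.comp h2)))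
  have hΔ' := measurable_generatedBy Δ
  have hX : Measurable[generatedBy Δ] fun ω => (obsTime Δ m ω, Δ m ω) :=
    (measurable_obsTime hΔ' m).prodMk (hΔ' m)
  have hX0 : Measurable fun ω => (obsTime Δ m ω, Δ m ω) :=
    (measurable_obsTime hmodel.measurable_obs m).prodMk (hmodel.measurable_obs m)
  have hY0 : Measurable fun ω i => t i ω := measurable_pi_lambda _ hmodel.attacks.measurable
  have hXY := indepFun_of_indep hmodel.indep_obs hX (measurable_iSup_comap t)
  have h1 : ∫ ω, Complex.exp (-h * obsTime Δ (m + 1) ω)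
        * (countProb a k (pastAttacks t Δ m ω).card * countProb a j (nextAttacks t Δ m ω).card) ∂P
      = ∫ ω, f ((obsTime Δ m ω, Δ m ω), fun i => t i ω) ∂P := by
    refine integral_congr_ae ?_
    filter_upwards [hreg] with ω hω
    simp only [hf, pastAttacks, nextAttacks]
    rw [card_finIndex (hω.finite _), card_finIndex (hω.finite_next m), obsTime_succ]
  have hfi : Integrable (fun ω => f ((obsTime Δ m ω, Δ m ω), fun i => t i ω)) P := by
    refine Integrable.of_bound (hfm.comp (hX0.prodMk hY0)).aestronglyMeasurable 1 ?_
    filter_upwards [hreg] with ω hω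
    simp only [hf, norm_mul]
    exact mul_le_one₀ (norm_cexp_neg_mul_le hh (add_nonneg (hω.obsTime_nonneg m) (hω.obs_nonneg m)))
      (by positivity) (mul_le_one₀ (norm_countProb_le ha ha' _ _) (norm_nonneg _)
        (norm_countProb_le ha ha' _ _))
  rw [h1, integral_eq_integral_integral_of_indepFun hX0 hY0 hXY hfm hfi]
  have hind : IndepFun (obsTime Δ m) (Δ m) P := by
    have := hmodel.obs_indep.indepFun_finsetSum_of_notMem hmodel.measurable_obs
      (Finset.notMem_range_self (n := m))
    refine this.congr (ae_of_all _ fun ω => ?_) (ae_of_all _ fun ω => rfl)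
    simp [obsTime]
  have h2 : ∀ᵐ ω ∂P, ∫ ω', f ((obsTime Δ m ω, Δ m ω), fun i => t i ω') ∂P
      = (fun s : ℝ => Complex.exp (-h * s) * nodeProb lam a k s) (obsTime Δ m ω)
        * (fun s : ℝ => Complex.exp (-h * s) * nodeProb lam a j s) (Δ m ω) := by
    filter_upwards [hreg] with ω hω
    simp only [hf]
    rw [integral_const_mul]
    have := integral_countProb_mul (a := a) hlam hmodel.attacks (hω.obsTime_nonneg m)
      (hω.obs_nonneg m) k j
    rw [show ∫ ω', countProb a k {i | t i ω' ∈ Icc 0 (obsTime Δ m ω)}.encard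
      * countProb a j {i | t i ω' ∈ Ioc (obsTime Δ m ω) (obsTime Δ m ω + Δ m ω)}.encard ∂P = _
      from this, Complex.ofReal_add, mul_add, Complex.exp_add]
    ring
  have hg : ∀ k, Continuous fun s : ℝ => Complex.exp (-h * s) * nodeProb lam a k s := fun k => by
    have := continuous_nodeProb lam a k
    fun_prop
  have hmO := measurable_obsTime hmodel.measurable_obs m
  have hlawO : P.map (obsTime Δ m) = sumLaw (expMeasure mu) m := by
    have := map_sum_eq_sumLaw hmodel.measurable_obs hmodel.obs_law hmodel.obs_indep
      (Finset.range m)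
    rwa [Finset.card_range] at this
  rw [integral_congr_ae h2, hind.integral_fun_comp_mul_comp hmO.aemeasurable
    (hmodel.measurable_obs m).aemeasurable (hg k).aestronglyMeasurable
    (hg j).aestronglyMeasurable, ← integral_nodeProb_expMeasure hlam hmu ha ha' j hh,
    ← hlawO, ← hmodel.obs_law m, integral_map hmO.aemeasurable (hg k).aestronglyMeasurable,
    integral_map (hmodel.measurable_obs m).aemeasurable (hg j).aestronglyMeasurable]

/-- The joint transform of the node counts and the observation epochs. -/
lemma integral_nodes (hmodel : IsExponentialModel P lam mu a ξ t n w Δ)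
    (hlam : 0 < lam) (hmu : 0 < mu) (ha : 0 < a) (ha' : a ≤ 1) (m k j : ℕ) {h : ℂ}
    (hh : 0 ≤ h.re) :
    ∫ ω, Complex.exp (-h * obsTime Δ (m + 1) ω)
        * ({(k, j)} : Set (ℕ × ℕ)).indicator 1 (∑ i ∈ pastAttacks t Δ m ω, n i ω,
            ∑ i ∈ nextAttacks t Δ m ω, n i ω) ∂P
      = (∫ s, Complex.exp (-h * (s : ℝ)) * nodeProb lam a k s ∂sumLaw (expMeasure mu) m)
        * (mu * nodeLaplace lam a j (mu + h)) := by
  have hreg := hmodel.ae_isRegularOutcome hlam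
  have := isProbabilityMeasure_geomLaw ha ha'
  have hm' : generatedBy t ⊔ generatedBy Δ ≤ mΩ := sup_le (hmodel.family_le 0) (hmodel.family_le 3)
  have ht' : ∀ i, Measurable[generatedBy t ⊔ generatedBy Δ] (t i) := fun i =>
    (measurable_generatedBy t i).mono le_sup_left le_rfl
  have hΔ' : ∀ i, Measurable[generatedBy t ⊔ generatedBy Δ] (Δ i) := fun i =>
    (measurable_generatedBy Δ i).mono le_sup_right le_rfl
  rw [integral_sum_random_index hmodel.measurable_nodes (hmodel.map_nodes ha ha')
    hmodel.nodes_indep hm' hmodel.indep_nodes (measurable_pastAttacks ht' hΔ' m)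
    (measurable_nextAttacks ht' hΔ' m) (disjoint_pastAttacks_nextAttacks m)
    (measurable_cexp_obsTime hΔ' h (m + 1)),
    ← hmodel.integral_countProb_attacks hlam hmu ha ha' m k j hh]
  · refine integral_congr_ae (ae_of_all _ fun ω => ?_)
    simp only
    rw [countProb_coe ha ha', countProb_coe ha ha', show (1 : ℕ × ℕ → ℂ) = fun _ => 1 from rfl,
      integral_indicator_const _ (measurableSet_singleton _), ← singleton_prod_singleton,
      measureReal_prod_prod]
    simp [attackProb]
  · filter_upwards [hreg] with ω hω
    exact norm_cexp_neg_mul_le hh (hω.obsTime_nonneg (m + 1))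
  · exact Measurable.of_discrete
  · refine ae_of_all _ fun ω => (norm_indicator_le_norm_self _ _).trans ?_
    simp

/-- The joint law of nodes, weights and epochs at two consecutive observations: given the numbers
`k` and `j` of nodes lost before and after `τ_m`, the weights are independent sums of `k` and of `j`
exponential variables. -/
lemma integral_nodes_weights (hmodel : IsExponentialModel P lam mu a ξ t n w Δ)
    (hlam : 0 < lam) (hmu : 0 < mu) (ha : 0 < a) (ha' : a ≤ 1) (m k j : ℕ)
    {h : ℂ} (hh : 0 ≤ h.re) {φ : ℝ × ℝ → ℂ} (hφ : Measurable φ)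
    (hφ1 : ∀ x y, 0 ≤ x → 0 ≤ y → ‖φ (x, y)‖ ≤ 1) :
    ∫ ω, Complex.exp (-h * obsTime Δ (m + 1) ω)
        * ({(k, j)} : Set (ℕ × ℕ)).indicator 1 (cumNodes t n Δ m ω,
            nodeLoss t n (obsWindow Δ (m + 1) ω) ω)
        * φ (cumWeight t n w Δ m ω, weightLoss t n w (obsWindow Δ (m + 1) ω) ω) ∂P
      = (∫ s, Complex.exp (-h * (s : ℝ)) * nodeProb lam a k s ∂sumLaw (expMeasure mu) m)
        * (mu * nodeLaplace lam a j (mu + h))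
        * ∫ x, φ x ∂(sumLaw (expMeasure ξ) k).prod (sumLaw (expMeasure ξ) j) := by
  have hreg := hmodel.ae_isRegularOutcome hlam
  have hm' : generatedBy t ⊔ generatedBy n ⊔ generatedBy Δ ≤ mΩ :=
    sup_le (sup_le (hmodel.family_le 0) (hmodel.family_le 1)) (hmodel.family_le 3)
  have ht' : ∀ i, Measurable[generatedBy t ⊔ generatedBy n ⊔ generatedBy Δ] (t i) := fun i =>
    (measurable_generatedBy t i).mono (le_sup_left.trans le_sup_left) le_rfl
  have hn' : ∀ i, Measurable[generatedBy t ⊔ generatedBy n ⊔ generatedBy Δ] (n i) := fun i =>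
    (measurable_generatedBy n i).mono (le_sup_right.trans le_sup_left) le_rfl
  have hΔ' : ∀ i, Measurable[generatedBy t ⊔ generatedBy n ⊔ generatedBy Δ] (Δ i) := fun i =>
    (measurable_generatedBy Δ i).mono le_sup_right le_rfl
  have hpast := measurable_pastAttacks ht' hΔ' m
  have hnext := measurable_nextAttacks ht' hΔ' m
  have hZ : Measurable[generatedBy t ⊔ generatedBy n ⊔ generatedBy Δ] fun ω =>
      Complex.exp (-h * obsTime Δ (m + 1) ω) * ({(k, j)} : Set (ℕ × ℕ)).indicator (1 : ℕ × ℕ → ℂ)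
        (∑ i ∈ pastAttacks t Δ m ω, n i ω, ∑ i ∈ nextAttacks t Δ m ω, n i ω) :=
    (measurable_cexp_obsTime hΔ' h (m + 1)).mul
    (measurable_indicator_nodes ht' hn' hΔ' m k j)
  have h1 := integral_sum_random_index (w := fun p : Σ _ : ℕ, ℕ => w p.1 p.2) (P := P) (φ := φ)
    (fun p => hmodel.measurable_weight p.1 p.2) (fun p => hmodel.weight_law p.1 p.2)
    (hmodel.weight_indep.precomp (g := fun p : Σ _ : ℕ, ℕ => (p.1, p.2))
      (fun p q hpq => by
        obtain ⟨p1, p2⟩ := p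
        obtain ⟨q1, q2⟩ := q
        simp_all)) hm' hmodel.indep_weights
    (measurable_lostNodes hn' hpast) (measurable_lostNodes hn' hnext)
    (fun ω => disjoint_lostNodes (disjoint_pastAttacks_nextAttacks m ω) ω) hZ ?_ hφ ?_
  · rw [← hmodel.integral_nodes hlam hmu ha ha' m k j hh, ← integral_mul_const]
    refine Eq.trans (integral_congr_ae ?_) (h1.trans (integral_congr_ae (ae_of_all _ fun ω => ?_)))
    · filter_upwards [hreg] with ω hω
      rw [hω.cumNodes_eq, hω.nodeLoss_eq, hω.cumWeight_eq, hω.weightLoss_eq]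
    · simp only [card_lostNodes]
      by_cases hkj : (∑ i ∈ pastAttacks t Δ m ω, n i ω, ∑ i ∈ nextAttacks t Δ m ω, n i ω) = (k, j)
      · rw [(Prod.mk.inj hkj).1, (Prod.mk.inj hkj).2]
      · rw [indicator_of_notMem (mem_singleton_iff.not.2 hkj), mul_zero, zero_mul, zero_mul]
  · filter_upwards [hreg] with ω hω
    rw [norm_mul]
    refine mul_le_one₀ (norm_cexp_neg_mul_le hh (hω.obsTime_nonneg (m + 1))) (norm_nonneg _) ?_
    refine (norm_indicator_le_norm_self _ _).trans ?_
    simp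
  · filter_upwards [hreg] with ω hω
    exact hφ1 _ _ (Finset.sum_nonneg fun p _ => hω.weight_nonneg _ _)
      (Finset.sum_nonneg fun p _ => hω.weight_nonneg _ _)

end IsExponentialModel

end JointLaw

/-! ### The first passage -/

section Passage

variable {Ω : Type*} {t : ℕ → Ω → ℝ} {n : ℕ → Ω → ℕ} {w : ℕ → ℕ → Ω → ℝ} {Δ : ℕ → Ω → ℝ}

lemma iInf_coe_le_iff (p : ℕ → Prop) (hp : ∀ i j, i ≤ j → p i → p j) (m : ℕ) :
    ⨅ i ∈ {i : ℕ | p i}, (i : ℕ∞) ≤ (m : ℕ∞) ↔ p m := by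
  constructor
  · intro h
    by_contra hm
    have h1 : ((m + 1 : ℕ) : ℕ∞) ≤ ⨅ i ∈ {i : ℕ | p i}, (i : ℕ∞) := by
      refine le_iInf₂ fun i hi => ?_
      have : m + 1 ≤ i := by
        by_contra hlt
        exact hm (hp i m (by omega) hi)
      exact_mod_cast this
    have h2 := h1.trans h
    have : m + 1 ≤ m := by exact_mod_cast h2
    omega
  · exact fun h => iInf₂_le m h

lemma nodeExit_le_iff (p m : ℕ) (ω : Ω) :
    nodeExit t n Δ p ω ≤ m ↔ p < cumNodes t n Δ m ω :=
  iInf_coe_le_iff (fun m => p < cumNodes t n Δ m ω)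
    (fun _ _ hij hi => hi.trans_le (monotone_cumNodes ω hij)) m

lemma IsRegularOutcome.firstExit_le_iff {ω : Ω} (hω : IsRegularOutcome t w Δ ω) (M : ℕ) (V : ℝ)
    (m : ℕ) :
    firstExit t n w Δ M V ω ≤ m ↔ M < cumNodes t n Δ m ω ∨ V < cumWeight t n w Δ m ω := by
  rw [firstExit, min_le_iff, nodeExit_le_iff]
  exact or_congr_right (iInf_coe_le_iff (fun m => V < cumWeight t n w Δ m ω)
    (fun _ _ hij hi => hi.trans_le (hω.monotone_cumWeight hij)) m)

/-- The event `μ₁ ≤ m`, `ρ = m + 1`: the first passage is observed at `τ_{m+1}`, and the threshold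
`M₁` has been crossed by `τ_m`. -/
def ExitsAfter (t : ℕ → Ω → ℝ) (n : ℕ → Ω → ℕ) (w : ℕ → ℕ → Ω → ℝ) (Δ : ℕ → Ω → ℝ)
    (M₁ M : ℕ) (V : ℝ) (m : ℕ) (ω : Ω) : Prop :=
  M₁ < cumNodes t n Δ m ω ∧ cumNodes t n Δ m ω ≤ M ∧ cumWeight t n w Δ m ω ≤ V ∧
    (M < cumNodes t n Δ (m + 1) ω ∨ V < cumWeight t n w Δ (m + 1) ω)

namespace IsRegularOutcome

variable {ω : Ω} {M₁ M : ℕ} {V : ℝ}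

lemma firstExit_eq (hω : IsRegularOutcome t w Δ ω) {m : ℕ}
    (hm : ExitsAfter t n w Δ M₁ M V m ω) :
    firstExit t n w Δ M V ω = (m + 1 : ℕ) ∧ nodeExit t n Δ M₁ ω < firstExit t n w Δ M V ω := by
  obtain ⟨h1, h2, h3, h4⟩ := hm
  have h5 := (hω.firstExit_le_iff (n := n) M V (m + 1)).2 h4
  have h6 : (m : ℕ∞) < firstExit t n w Δ M V ω := by
    rw [← not_le, hω.firstExit_le_iff]
    push Not
    exact ⟨h2, h3⟩
  refine ⟨le_antisymm h5 ?_, ((nodeExit_le_iff M₁ m ω).2 h1).trans_lt h6⟩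
  have := Order.add_one_le_of_lt h6
  exact_mod_cast this

lemma exists_exitsAfter (hω : IsRegularOutcome t w Δ ω) (hM : ∃ m, M < cumNodes t n Δ m ω)
    (h : nodeExit t n Δ M₁ ω < firstExit t n w Δ M V ω) : ∃ m, ExitsAfter t n w Δ M₁ M V m ω := by
  obtain ⟨m₀, hm₀⟩ := hM
  have h1 := (hω.firstExit_le_iff (n := n) M V m₀).2 (Or.inl hm₀)
  obtain ⟨r, hr⟩ := ENat.ne_top_iff_exists.1 (h1.trans_lt (ENat.natCast_lt_top m₀)).ne
  obtain ⟨q, hq⟩ := ENat.ne_top_iff_exists.1 (h.trans_le le_top).ne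
  have hqr : q < r := by rw [← hr, ← hq] at h; exact_mod_cast h
  obtain ⟨m, rfl⟩ : ∃ m, r = m + 1 := ⟨r - 1, by omega⟩
  refine ⟨m, (nodeExit_le_iff M₁ m ω).1 ?_, ?_⟩
  · rw [← hq]
    exact_mod_cast Nat.lt_succ_iff.1 hqr
  · have h2 := (hω.firstExit_le_iff (n := n) M V (m + 1)).1 hr.ge
    have h3 : ¬ firstExit t n w Δ M V ω ≤ m := by
      rw [← hr, not_le]
      exact_mod_cast Nat.lt_succ_self m
    rw [hω.firstExit_le_iff] at h3
    push Not at h3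
    exact ⟨h3.1, h3.2, h2⟩

end IsRegularOutcome

/-- The contribution of the weights to the exit variable when `k` nodes are lost up to `τ_m` and `j`
in the next window; `x` and `y` are the weights. -/
noncomputable def weightFactor (M : ℕ) (V : ℝ) (α β : ℂ) (k j : ℕ) : ℝ × ℝ → ℂ :=
  {p | p.1 ≤ V ∧ (M < k + j ∨ V < p.1 + p.2)}.indicator
    fun p => α ^ (k + j) * Complex.exp (-β * (p.1 + p.2 : ℝ))

/-- The part of the exit variable on the event `ρ = m + 1`, `N_m = k`, `N_{m+1} = k + j`, for
`k ≤ M`. -/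
noncomputable def exitTerm (t : ℕ → Ω → ℝ) (n : ℕ → Ω → ℕ) (w : ℕ → ℕ → Ω → ℝ)
    (Δ : ℕ → Ω → ℝ) (M : ℕ) (V : ℝ) (α β h : ℂ) (m k j : ℕ) (ω : Ω) : ℂ :=
  Complex.exp (-h * obsTime Δ (m + 1) ω)
    * ({(k, j)} : Set (ℕ × ℕ)).indicator 1 (cumNodes t n Δ m ω,
        nodeLoss t n (obsWindow Δ (m + 1) ω) ω)
    * weightFactor M V α β k j (cumWeight t n w Δ m ω, weightLoss t n w (obsWindow Δ (m + 1) ω) ω)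

lemma exitTerm_ne_zero {M₁ M m k j : ℕ} {V : ℝ} {α β h : ℂ} {ω : Ω} (hk : M₁ < k) (hk' : k ≤ M)
    (h0 : exitTerm t n w Δ M V α β h m k j ω ≠ 0) :
    ExitsAfter t n w Δ M₁ M V m ω ∧ cumNodes t n Δ m ω = k ∧
      nodeLoss t n (obsWindow Δ (m + 1) ω) ω = j := by
  rw [exitTerm] at h0
  have h1 := Set.mem_of_indicator_ne_zero (right_ne_zero_of_mul (left_ne_zero_of_mul h0))
  have h2 := Set.mem_of_indicator_ne_zero (right_ne_zero_of_mul h0)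
  obtain ⟨h3, h4⟩ := Prod.mk.inj h1
  refine ⟨⟨by omega, by omega, h2.1, ?_⟩, h3, h4⟩
  rw [cumNodes_succ, cumWeight_succ, h3, h4]
  exact h2.2

/-- The exit variable is the sum of its parts; at most one of them is nonzero. -/
lemma IsRegularOutcome.hasSum_exitTerm {ω : Ω} (hω : IsRegularOutcome t w Δ ω) (M₁ L : ℕ) (V : ℝ)
    (α β h : ℂ) (hM : ∃ m, M₁ + L < cumNodes t n Δ m ω) :
    HasSum (fun i : Fin L × ℕ × ℕ =>
        exitTerm t n w Δ (M₁ + L) V α β h i.2.1 (M₁ + i.1 + 1) i.2.2 ω)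
      (exitVariable t n w Δ M₁ (M₁ + L) V α β h ω) := by
  by_cases hex : ∃ m, ExitsAfter t n w Δ M₁ (M₁ + L) V m ω
  · obtain ⟨m, hm⟩ := hex
    obtain ⟨hr, hlt⟩ := hω.firstExit_eq hm
    obtain ⟨h1, h2, h3, h4⟩ := hm
    set N := cumNodes t n Δ m ω with hN
    set X := nodeLoss t n (obsWindow Δ (m + 1) ω) ω with hX
    let i₀ : Fin L × ℕ × ℕ := (⟨N - (M₁ + 1), by omega⟩, m, X)
    have hi₀ : M₁ + (N - (M₁ + 1)) + 1 = N := by omega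
    have hval : exitTerm t n w Δ (M₁ + L) V α β h i₀.2.1 (M₁ + i₀.1 + 1) i₀.2.2 ω
        = exitVariable t n w Δ M₁ (M₁ + L) V α β h ω := by
      simp only [i₀]
      rw [hi₀, exitTerm, ← hN, ← hX, indicator_of_mem (mem_singleton _), weightFactor,
        indicator_of_mem, exitVariable, indicator_of_mem (by exact hlt), hr, ENat.toNat_natCast,
        cumNodes_succ, cumWeight_succ, ← hN, ← hX]
      · simp
        ring
      · rw [cumNodes_succ, cumWeight_succ] at h4
        exact ⟨h3, h4⟩
    rw [← hval]
    refine hasSum_single i₀ fun i hi => ?_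
    by_contra h0
    obtain ⟨i1, m', j⟩ := i
    obtain ⟨e1, e2, e3⟩ := exitTerm_ne_zero (M₁ := M₁) (by omega) (by omega) h0
    have e4 := (hω.firstExit_eq e1).1
    rw [hr] at e4
    have e5 : m' = m := by
      have : m + 1 = m' + 1 := by exact_mod_cast e4
      omega
    simp only at e1 e2 e3
    subst e5
    refine hi (Prod.ext (Fin.ext ?_) (Prod.ext rfl e3.symm))
    simp only [i₀]
    omega
  · have h0 : exitVariable t n w Δ M₁ (M₁ + L) V α β h ω = 0 := by
      rw [exitVariable, indicator_of_notMem]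
      exact fun hlt => hex (hω.exists_exitsAfter hM hlt)
    rw [h0]
    convert hasSum_zero with i
    by_contra h1
    exact hex ⟨_, (exitTerm_ne_zero (M₁ := M₁) (by omega) (by omega) h1).1⟩

lemma measurable_weightFactor (M : ℕ) (V : ℝ) (α β : ℂ) (k j : ℕ) :
    Measurable (weightFactor M V α β k j) := by
  refine Measurable.indicator (by fun_prop) ?_
  refine (measurableSet_le measurable_fst measurable_const).inter ?_
  exact (MeasurableSet.const _).union
    (measurableSet_lt measurable_const (measurable_fst.add measurable_snd))

lemma norm_weightFactor_le {α β : ℂ} (hα' : ‖α‖ ≤ 1) (hβ : 0 ≤ β.re) (M : ℕ) (V : ℝ) (k j : ℕ)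
    (x y : ℝ) (hx : 0 ≤ x) (hy : 0 ≤ y) : ‖weightFactor M V α β k j (x, y)‖ ≤ 1 := by
  refine (norm_indicator_le_norm_self _ _).trans ?_
  rw [norm_mul, norm_pow]
  exact mul_le_one₀ (pow_le_one₀ (norm_nonneg _) hα') (norm_nonneg _)
    (norm_cexp_neg_mul_le hβ (add_nonneg hx hy))

/-- Exit in the next window is the complement of staying below both thresholds, and staying below
`V` after the next window entails it before. -/
lemma integral_weightFactor {ξ V : ℝ} (hξ : 0 < ξ) (hV : 0 < V) {α β : ℂ} (hβ : 0 ≤ β.re)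
    (M k j : ℕ) :
    ∫ p, weightFactor M V α β k j p ∂(sumLaw (expMeasure ξ) k).prod (sumLaw (expMeasure ξ) j)
      = α ^ (k + j) * (truncLaplace ξ V β k * lFun ξ β ^ j
        - if k + j ≤ M then truncLaplace ξ V β (k + j) else 0) := by
  have := isProbabilityMeasure_expMeasure hξ
  set κ := (sumLaw (expMeasure ξ) k).prod (sumLaw (expMeasure ξ) j) with hκ
  have hx : ∀ᵐ p ∂κ, 0 ≤ p.1 :=
    Measure.quasiMeasurePreserving_fst.ae (ae_nonneg_sumLaw_expMeasure hξ k)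
  have hy : ∀ᵐ p ∂κ, 0 ≤ p.2 :=
    Measure.quasiMeasurePreserving_snd.ae (ae_nonneg_sumLaw_expMeasure hξ j)
  set g : ℝ → ℂ := (Iic V).indicator fun x : ℝ => Complex.exp (-β * x) with hg
  have hgm : Measurable g := Measurable.indicator (by fun_prop) measurableSet_Iic
  have hg1 : ∀ x : ℝ, 0 ≤ x → ‖g x‖ ≤ 1 := fun x hx =>
    (norm_indicator_le_norm_self _ _).trans (norm_cexp_neg_mul_le hβ hx)
  have hsplit : ∀ᵐ p ∂κ, weightFactor M V α β k j p = α ^ (k + j) *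
      (g p.1 * Complex.exp (-β * (p.2 : ℝ)) - if k + j ≤ M then g (p.1 + p.2) else 0) := by
    filter_upwards [hx, hy] with p h1 h2
    have he : Complex.exp (-β * (p.1 + p.2 : ℝ))
        = Complex.exp (-β * (p.1 : ℝ)) * Complex.exp (-β * (p.2 : ℝ)) := by
      rw [← Complex.exp_add]
      push_cast
      ring_nf
    rw [weightFactor, indicator_apply]
    simp only [hg, indicator_apply, mem_ofPred_eq, mem_Iic, he]
    by_cases hM : k + j ≤ M
    · by_cases hs : p.1 + p.2 ≤ V
      · have : p.1 ≤ V := by linarith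
        simp [hM, hs, this]
      · by_cases h3 : p.1 ≤ V <;> simp [hM, hs, h3, not_le.1]
    · by_cases h3 : p.1 ≤ V <;> simp [hM, h3, not_le.1 hM]
  have hi1 : Integrable (fun p : ℝ × ℝ => g p.1 * Complex.exp (-β * (p.2 : ℝ))) κ := by
    refine Integrable.of_bound (by fun_prop) 1 ?_
    filter_upwards [hx, hy] with p h1 h2
    rw [norm_mul]
    exact mul_le_one₀ (hg1 _ h1) (norm_nonneg _) (norm_cexp_neg_mul_le hβ h2)
  have hi2 : Integrable (fun p : ℝ × ℝ => g (p.1 + p.2)) κ := by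
    refine Integrable.of_bound (hgm.comp measurable_add).aestronglyMeasurable 1 ?_
    filter_upwards [hx, hy] with p h1 h2
    exact hg1 _ (add_nonneg h1 h2)
  have e1 : ∫ p, g p.1 * Complex.exp (-β * (p.2 : ℝ)) ∂κ
      = truncLaplace ξ V β k * lFun ξ β ^ j := by
    rw [hκ, integral_prod_mul g fun y : ℝ => Complex.exp (-β * y), integral_cexp_sumLaw hξ hβ,
      hg, integral_truncated_sumLaw hξ hV hβ]
  have e2 : ∫ p, g (p.1 + p.2) ∂κ = truncLaplace ξ V β (k + j) := by
    rw [← integral_truncated_sumLaw hξ hV hβ, sumLaw_add, Measure.conv, integral_map]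
    · exact measurable_add.aemeasurable
    · exact hgm.aestronglyMeasurable
  rw [integral_congr_ae hsplit, integral_const_mul]
  split_ifs with hM
  · rw [integral_sub hi1 hi2, e1, e2]
  · simp only [sub_zero, e1]

/-- The sum over the number `j` of nodes lost in the window of the passage. The term `j = 0`
vanishes. -/
lemma hasSum_window {lam mu a ξ V : ℝ} (hlam : 0 < lam) (hmu : 0 < mu) (ha : 0 < a) (ha' : a ≤ 1)
    (hξ : 0 < ξ) {α β h : ℂ} (hα' : ‖α‖ ≤ 1) (hβ : 0 ≤ β.re) (hh : 0 ≤ h.re) (M k : ℕ)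
    (hk : k ≤ M) :
    HasSum (fun j => mu * nodeLaplace lam a j (mu + h)
        * (α ^ (k + j) * (truncLaplace ξ V β k * lFun ξ β ^ j
          - if k + j ≤ M then truncLaplace ξ V β (k + j) else 0)))
      (mu * (a * lam / (lam + (mu + h)) ^ 2)
          * (α * lFun ξ β / (1 - dFun lam mu a h * (α * lFun ξ β))
              * (α ^ k * truncLaplace ξ V β k)
            - ∑ i ∈ Finset.range (M - k), dFun lam mu a h ^ i
              * (α ^ (k + i + 1) * truncLaplace ξ V β (k + i + 1)))) := by
  have hmh : 0 < ((mu : ℂ) + h).re := by simp; linarith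
  have hd1 : ‖dFun lam mu a h‖ < 1 := by rw [dFun_eq_cFun]; exact norm_cFun_lt_one hlam ha ha' hmh
  have hl := norm_lFun_le_one hξ hβ
  have hnorm : ‖dFun lam mu a h * (α * lFun ξ β)‖ < 1 := by
    rw [norm_mul, norm_mul]
    have : ‖α‖ * ‖lFun ξ β‖ ≤ 1 := mul_le_one₀ hα' (norm_nonneg _) hl
    nlinarith [norm_nonneg (dFun lam mu a h), norm_nonneg (lFun ξ β), norm_nonneg α]
  refine (hasSum_nat_add_iff' 1).1 ?_
  have hgeo := (hasSum_geometric_of_norm_lt_one hnorm).mul_left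
    (α * lFun ξ β * (α ^ k * truncLaplace ξ V β k))
  have hfin : HasSum (fun i => if k + (i + 1) ≤ M then dFun lam mu a h ^ i
        * (α ^ (k + i + 1) * truncLaplace ξ V β (k + i + 1)) else 0)
      (∑ i ∈ Finset.range (M - k), dFun lam mu a h ^ i
        * (α ^ (k + i + 1) * truncLaplace ξ V β (k + i + 1))) := by
    have h1 : ∑ i ∈ Finset.range (M - k), dFun lam mu a h ^ i
          * (α ^ (k + i + 1) * truncLaplace ξ V β (k + i + 1))
        = ∑ i ∈ Finset.range (M - k), if k + (i + 1) ≤ M then dFun lam mu a h ^ i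
          * (α ^ (k + i + 1) * truncLaplace ξ V β (k + i + 1)) else 0 :=
      Finset.sum_congr rfl fun i hi => (if_pos (by rw [Finset.mem_range] at hi; omega)).symm
    rw [h1]
    exact hasSum_sum_of_ne_finset_zero fun i hi =>
      if_neg (by rw [Finset.mem_range] at hi; omega)
  have hall := (hgeo.sub hfin).mul_left (mu * (a * lam / (lam + (mu + h)) ^ 2) : ℂ)
  rw [Finset.sum_range_one, Nat.add_zero, if_pos hk, pow_zero, mul_one, sub_self, mul_zero,
    mul_zero, sub_zero]
  rw [div_mul_eq_mul_div, div_eq_mul_inv (α * lFun ξ β * _)]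
  refine hall.congr_fun fun i => ?_
  rw [nodeLaplace_succ, ← dFun_eq_cFun, ← Nat.add_assoc]
  split_ifs <;> rw [mul_pow] <;> ring

end Passage

/-! ### Summation over all passages -/

section Expectation

variable {Ω : Type*} {mΩ : MeasurableSpace Ω} {P : Measure Ω} [IsProbabilityMeasure P]
  {lam mu a ξ : ℝ} {t : ℕ → Ω → ℝ} {n : ℕ → Ω → ℕ} {w : ℕ → ℕ → Ω → ℝ} {Δ : ℕ → Ω → ℝ}

namespace IsExponentialModel

lemma aemeasurable_nodes (hmodel : IsExponentialModel P lam mu a ξ t n w Δ) (hlam : 0 < lam)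
    (m : ℕ) : AEMeasurable (fun ω => (cumNodes t n Δ m ω,
      nodeLoss t n (obsWindow Δ (m + 1) ω) ω)) P := by
  refine ⟨fun ω => (∑ i ∈ pastAttacks t Δ m ω, n i ω, ∑ i ∈ nextAttacks t Δ m ω, n i ω), ?_, ?_⟩
  · exact (measurable_sum_nodes hmodel.measurable_nodes
      (measurable_pastAttacks hmodel.attacks.measurable hmodel.measurable_obs m)).prodMk
      (measurable_sum_nodes hmodel.measurable_nodes
      (measurable_nextAttacks hmodel.attacks.measurable hmodel.measurable_obs m))
  · filter_upwards [hmodel.ae_isRegularOutcome hlam] with ω hω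
    rw [hω.cumNodes_eq, hω.nodeLoss_eq]

lemma aemeasurable_weights (hmodel : IsExponentialModel P lam mu a ξ t n w Δ) (hlam : 0 < lam)
    (m : ℕ) : AEMeasurable (fun ω => (cumWeight t n w Δ m ω,
      weightLoss t n w (obsWindow Δ (m + 1) ω) ω)) P := by
  refine ⟨fun ω => (∑ p ∈ lostNodes n (pastAttacks t Δ m ω) ω, w p.1 p.2 ω,
    ∑ p ∈ lostNodes n (nextAttacks t Δ m ω) ω, w p.1 p.2 ω), ?_, ?_⟩
  · exact (measurable_sum_weights hmodel.measurable_weight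
      (measurable_lostNodes hmodel.measurable_nodes
        (measurable_pastAttacks hmodel.attacks.measurable hmodel.measurable_obs m))).prodMk
      (measurable_sum_weights hmodel.measurable_weight
      (measurable_lostNodes hmodel.measurable_nodes
        (measurable_nextAttacks hmodel.attacks.measurable hmodel.measurable_obs m)))
  · filter_upwards [hmodel.ae_isRegularOutcome hlam] with ω hω
    rw [hω.cumWeight_eq, hω.weightLoss_eq]

/-- The joint probability of `k` nodes lost up to `τ_m` and `j` in the next window. -/
lemma prob_nodes (hmodel : IsExponentialModel P lam mu a ξ t n w Δ)
    (hlam : 0 < lam) (hmu : 0 < mu) (ha : 0 < a) (ha' : a ≤ 1) (hξ : 0 < ξ) (m k j : ℕ) :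
    (P.real {ω | (cumNodes t n Δ m ω, nodeLoss t n (obsWindow Δ (m + 1) ω) ω) = (k, j)} : ℂ)
      = (∫ s, Complex.exp (-0 * (s : ℝ)) * nodeProb lam a k s ∂sumLaw (expMeasure mu) m)
        * (mu * nodeLaplace lam a j (mu + 0)) := by
  have := isProbabilityMeasure_expMeasure hξ
  have h1 := hmodel.integral_nodes_weights hlam hmu ha ha' m k j (h := 0) le_rfl (φ := fun _ => 1)
    measurable_const (fun _ _ _ _ => by simp)
  simp only [neg_zero, zero_mul, Complex.exp_zero, one_mul, mul_one, integral_const,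
    probReal_univ, one_smul] at h1
  simp only [neg_zero, zero_mul, Complex.exp_zero, one_mul]
  rw [← h1]
  have hs : NullMeasurableSet {ω | (cumNodes t n Δ m ω,
      nodeLoss t n (obsWindow Δ (m + 1) ω) ω) = (k, j)} P :=
    (hmodel.aemeasurable_nodes hlam m).nullMeasurable (measurableSet_singleton (k, j))
  have h2 : (fun ω => ({(k, j)} : Set (ℕ × ℕ)).indicator (1 : ℕ × ℕ → ℂ)
      (cumNodes t n Δ m ω, nodeLoss t n (obsWindow Δ (m + 1) ω) ω))
      = {ω | (cumNodes t n Δ m ω, nodeLoss t n (obsWindow Δ (m + 1) ω) ω) = (k, j)}.indicator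
        fun _ => 1 := by
    funext ω
    simp only [indicator_apply, mem_singleton_iff, mem_ofPred_eq, Pi.one_apply]
  rw [h2, integral_indicator₀ hs, setIntegral_const]
  simp

/-- Almost surely every threshold is crossed eventually: the probability that both `N_m` and the
loss in the next window stay below `M` is the general term of a convergent series. -/
lemma ae_exists_lt_cumNodes (hmodel : IsExponentialModel P lam mu a ξ t n w Δ)
    (hlam : 0 < lam) (hmu : 0 < mu) (ha : 0 < a) (ha' : a ≤ 1) (hξ : 0 < ξ) (M : ℕ) :
    ∀ᵐ ω ∂P, ∃ m, M < cumNodes t n Δ m ω := by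
  set E : ℕ → ℕ → ℕ → Set Ω := fun m k j =>
    {ω | (cumNodes t n Δ m ω, nodeLoss t n (obsWindow Δ (m + 1) ω) ω) = (k, j)} with hE
  have hle : ∀ m, P.real {ω | ¬ ∃ m, M < cumNodes t n Δ m ω}
      ≤ ∑ p ∈ Finset.range (M + 1) ×ˢ Finset.range (M + 1), P.real (E m p.1 p.2) := by
    intro m
    refine (measureReal_mono ?_ (measure_ne_top _ _)).trans (measureReal_biUnion_finset_le _ _)
    intro ω hω
    have hω' : ∀ m, cumNodes t n Δ m ω ≤ M := by
      have : ¬ ∃ m, M < cumNodes t n Δ m ω := hω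
      push Not at this
      exact this
    have h1 := hω' (m + 1)
    rw [cumNodes_succ] at h1
    refine mem_iUnion₂.2 ⟨(cumNodes t n Δ m ω, nodeLoss t n (obsWindow Δ (m + 1) ω) ω), ?_, rfl⟩
    simp only [Finset.mem_product, Finset.mem_range]
    omega
  have hlim : Filter.Tendsto (fun m => ∑ p ∈ Finset.range (M + 1) ×ˢ Finset.range (M + 1),
      P.real (E (m + 1) p.1 p.2)) Filter.atTop (nhds 0) := by
    rw [← Finset.sum_const_zero (s := Finset.range (M + 1) ×ˢ Finset.range (M + 1))]
    refine tendsto_finsetSum _ fun p _ => ?_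
    have h1 := (hasSum_integral_nodeProb_succ hlam hmu ha ha' p.1 (h := 0)
      le_rfl).summable.tendsto_atTop_zero.mul_const (mu * nodeLaplace lam a p.2 (mu + 0))
    rw [zero_mul] at h1
    simp only [← hmodel.prob_nodes hlam hmu ha ha' hξ] at h1
    exact (Complex.continuous_re.tendsto 0).comp h1
  have h0 : P.real {ω | ¬ ∃ m, M < cumNodes t n Δ m ω} ≤ 0 :=
    ge_of_tendsto' hlim fun m => hle (m + 1)
  rw [ae_iff]
  exact (measureReal_eq_zero_iff (measure_ne_top _ _)).1 (le_antisymm h0 measureReal_nonneg)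

variable {V : ℝ} {α β h : ℂ}

lemma norm_exitTerm_le (hα' : ‖α‖ ≤ 1) (hβ : 0 ≤ β.re) (hh : 0 ≤ h.re) {ω : Ω}
    (hω : IsRegularOutcome t w Δ ω) (M m k j : ℕ) :
    ‖exitTerm t n w Δ M V α β h m k j ω‖
      ≤ {ω | (cumNodes t n Δ m ω, nodeLoss t n (obsWindow Δ (m + 1) ω) ω) = (k, j)}.indicator
        (fun _ => (1 : ℝ)) ω := by
  have hW : 0 ≤ cumWeight t n w Δ m ω := Finset.sum_nonneg fun i _ => hω.weightLoss_nonneg _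
  have h1 := norm_cexp_neg_mul_le hh (hω.obsTime_nonneg (m + 1))
  have h2 := norm_weightFactor_le hα' hβ M V k j _ _ hW (hω.weightLoss_nonneg
    (n := n) (obsWindow Δ (m + 1) ω))
  rw [exitTerm, norm_mul, norm_mul]
  by_cases hkj : (cumNodes t n Δ m ω, nodeLoss t n (obsWindow Δ (m + 1) ω) ω) = (k, j)
  · rw [indicator_of_mem (s := {ω | _}) (by exact hkj), hkj, indicator_of_mem (mem_singleton _)]
    simpa using mul_le_one₀ h1 (norm_nonneg _) h2
  · rw [indicator_of_notMem (s := {ω | _}) (by exact hkj),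
      indicator_of_notMem (mem_singleton_iff.not.2 hkj)]
    simp

lemma integrable_exitTerm (hmodel : IsExponentialModel P lam mu a ξ t n w Δ) (hlam : 0 < lam)
    (hα' : ‖α‖ ≤ 1) (hβ : 0 ≤ β.re) (hh : 0 ≤ h.re) (M m k j : ℕ) :
    Integrable (exitTerm t n w Δ M V α β h m k j) P := by
  refine Integrable.of_bound ?_ 1 ?_
  · refine AEMeasurable.aestronglyMeasurable ?_
    have h1 := measurable_cexp_obsTime hmodel.measurable_obs h (m + 1)
    have h2 : AEMeasurable (fun ω => ({(k, j)} : Set (ℕ × ℕ)).indicator (1 : ℕ × ℕ → ℂ)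
        (cumNodes t n Δ m ω, nodeLoss t n (obsWindow Δ (m + 1) ω) ω)) P :=
      (Measurable.of_discrete (f := ({(k, j)} : Set (ℕ × ℕ)).indicator
        (1 : ℕ × ℕ → ℂ))).comp_aemeasurable (hmodel.aemeasurable_nodes hlam m)
    have h3 := (measurable_weightFactor M V α β k j).comp_aemeasurable
      (hmodel.aemeasurable_weights hlam m)
    exact (h1.aemeasurable.mul h2).mul h3
  · filter_upwards [hmodel.ae_isRegularOutcome hlam] with ω hω
    exact (norm_exitTerm_le hα' hβ hh hω M m k j).trans
      (indicator_le_self' (fun _ _ => zero_le_one) ω)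

/-- The expectations of the parts of the exit variable add up to that of the exit variable. -/
lemma hasSum_integral_exitTerm (hmodel : IsExponentialModel P lam mu a ξ t n w Δ) (hlam : 0 < lam)
    (hmu : 0 < mu) (ha : 0 < a) (ha' : a ≤ 1) (hξ : 0 < ξ) (hα' : ‖α‖ ≤ 1) (hβ : 0 ≤ β.re)
    (hh : 0 ≤ h.re) (M₁ L : ℕ) :
    HasSum (fun i : Fin L × ℕ × ℕ =>
        ∫ ω, exitTerm t n w Δ (M₁ + L) V α β h i.2.1 (M₁ + i.1 + 1) i.2.2 ω ∂P)
      (∫ ω, exitVariable t n w Δ M₁ (M₁ + L) V α β h ω ∂P) := by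
  have hreg := hmodel.ae_isRegularOutcome hlam
  have hsum : Summable fun i : Fin L × ℕ × ℕ =>
      ∫ ω, ‖exitTerm t n w Δ (M₁ + L) V α β h i.2.1 (M₁ + i.1 + 1) i.2.2 ω‖ ∂P := by
    have hb : Summable fun i : Fin L × ℕ × ℕ => P.real {ω | (cumNodes t n Δ i.2.1 ω,
        nodeLoss t n (obsWindow Δ (i.2.1 + 1) ω) ω) = (M₁ + i.1 + 1, i.2.2)} := by
      refine (summable_prod_of_nonneg fun _ => measureReal_nonneg).2 ⟨fun i => ?_, ?_⟩
      · have h1 := (hasSum_integral_nodeProb hlam hmu ha ha' (M₁ + i) (h := 0) le_rfl).summable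
        have h2 : Summable fun j => (mu * nodeLaplace lam a j (mu + 0) : ℂ) := by
          refine (summable_nat_add_iff 1).1 ?_
          have hd : ‖cFun lam a (mu + 0)‖ < 1 := norm_cFun_lt_one hlam ha ha' (by simpa using hmu)
          simp only [nodeLaplace_succ]
          exact ((summable_geometric_of_norm_lt_one hd).mul_left _).mul_left _
        have h3 := summable_mul_of_summable_norm h1.norm h2.norm
        simp only [← hmodel.prob_nodes hlam hmu ha ha' hξ] at h3
        exact Complex.summable_ofReal.1 h3
      · exact Summable.of_finite
    refine hb.of_nonneg_of_le (fun _ => integral_nonneg fun _ => norm_nonneg _) fun i => ?_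
    have hs : NullMeasurableSet {ω | (cumNodes t n Δ i.2.1 ω,
        nodeLoss t n (obsWindow Δ (i.2.1 + 1) ω) ω) = (M₁ + i.1 + 1, i.2.2)} P :=
      (hmodel.aemeasurable_nodes hlam i.2.1).nullMeasurable (measurableSet_singleton _)
    have h1 : ∫ ω, {ω | (cumNodes t n Δ i.2.1 ω, nodeLoss t n (obsWindow Δ (i.2.1 + 1) ω) ω)
        = (M₁ + i.1 + 1, i.2.2)}.indicator (fun _ => (1 : ℝ)) ω ∂P
        = P.real {ω | (cumNodes t n Δ i.2.1 ω, nodeLoss t n (obsWindow Δ (i.2.1 + 1) ω) ω)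
          = (M₁ + i.1 + 1, i.2.2)} :=
      (integral_indicator₀ hs).trans (by rw [setIntegral_const, smul_eq_mul, mul_one])
    rw [← h1]
    refine integral_mono_ae (hmodel.integrable_exitTerm hlam hα' hβ hh _ _ _ _).norm
      ((integrable_const (1 : ℝ)).indicator₀ hs) ?_
    filter_upwards [hreg] with ω hω
    exact norm_exitTerm_le hα' hβ hh hω _ _ _ _
  have h1 := hasSum_integral_of_summable_integral_norm
    (fun i : Fin L × ℕ × ℕ => hmodel.integrable_exitTerm (V := V) hlam hα' hβ hh (M₁ + L) i.2.1
      (M₁ + i.1 + 1) i.2.2) hsum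
  have h2 : ∫ ω, exitVariable t n w Δ M₁ (M₁ + L) V α β h ω ∂P
      = ∫ ω, ∑' i : Fin L × ℕ × ℕ,
        exitTerm t n w Δ (M₁ + L) V α β h i.2.1 (M₁ + i.1 + 1) i.2.2 ω ∂P := by
    refine integral_congr_ae ?_
    filter_upwards [hreg, hmodel.ae_exists_lt_cumNodes hlam hmu ha ha' hξ (M₁ + L)] with ω hω hM
    exact (hω.hasSum_exitTerm M₁ L V α β h hM).tsum_eq.symm
  rw [h2]
  exact h1

lemma integrable_exitVariable (hmodel : IsExponentialModel P lam mu a ξ t n w Δ) (hlam : 0 < lam)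
    (hmu : 0 < mu) (ha : 0 < a) (ha' : a ≤ 1) (hξ : 0 < ξ) (hα' : ‖α‖ ≤ 1) (hβ : 0 ≤ β.re)
    (hh : 0 ≤ h.re) (M₁ L : ℕ) : Integrable (exitVariable t n w Δ M₁ (M₁ + L) V α β h) P := by
  have hreg := hmodel.ae_isRegularOutcome hlam
  refine Integrable.of_bound ?_ 1 ?_
  · refine aestronglyMeasurable_of_tendsto_ae Filter.atTop
      (f := fun (s : Finset (Fin L × ℕ × ℕ)) ω => ∑ i ∈ s,
        exitTerm t n w Δ (M₁ + L) V α β h i.2.1 (M₁ + i.1 + 1) i.2.2 ω) (fun s => ?_) ?_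
    · exact (integrable_finsetSum s fun i _ =>
        hmodel.integrable_exitTerm hlam hα' hβ hh _ _ _ _).aestronglyMeasurable
    · filter_upwards [hreg, hmodel.ae_exists_lt_cumNodes hlam hmu ha ha' hξ (M₁ + L)] with ω hω hM
      exact hω.hasSum_exitTerm M₁ L V α β h hM
  · filter_upwards [hreg] with ω hω
    refine (norm_indicator_le_norm_self _ _).trans ?_
    rw [norm_mul, norm_mul, norm_pow]
    exact mul_le_one₀ (mul_le_one₀ (pow_le_one₀ (norm_nonneg _) hα') (norm_nonneg _)
      (norm_cexp_neg_mul_le hβ (Finset.sum_nonneg fun i _ => hω.weightLoss_nonneg _)))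
      (norm_nonneg _) (norm_cexp_neg_mul_le hh (hω.obsTime_nonneg _))

lemma integral_exitVariable (hmodel : IsExponentialModel P lam mu a ξ t n w Δ) (hlam : 0 < lam)
    (hmu : 0 < mu) (ha : 0 < a) (ha' : a ≤ 1) (hξ : 0 < ξ) (hV : 0 < V) (hα' : ‖α‖ ≤ 1)
    (hβ : 0 ≤ β.re) (hh : 0 ≤ h.re) (M₁ L : ℕ) :
    ∫ ω, exitVariable t n w Δ M₁ (M₁ + L) V α β h ω ∂P
      = ∑ i ∈ Finset.range L, mu * nodeLaplace lam a (M₁ + i + 1) h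
          * (mu * (a * lam / (lam + (mu + h)) ^ 2))
          * (α * lFun ξ β / (1 - dFun lam mu a h * (α * lFun ξ β))
              * (α ^ (M₁ + i + 1) * truncLaplace ξ V β (M₁ + i + 1))
            - ∑ j ∈ Finset.range (L - 1 - i), dFun lam mu a h ^ j
              * (α ^ (M₁ + i + 1 + j + 1) * truncLaplace ξ V β (M₁ + i + 1 + j + 1))) := by
  have hs := hmodel.hasSum_integral_exitTerm (V := V) hlam hmu ha ha' hξ hα' hβ hh M₁ L
  have hterm : ∀ m k j, ∫ ω, exitTerm t n w Δ (M₁ + L) V α β h m k j ω ∂P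
      = (∫ s, Complex.exp (-h * (s : ℝ)) * nodeProb lam a k s ∂sumLaw (expMeasure mu) m)
        * (mu * nodeLaplace lam a j (mu + h) * (α ^ (k + j) * (truncLaplace ξ V β k * lFun ξ β ^ j
        - if k + j ≤ M₁ + L then truncLaplace ξ V β (k + j) else 0))) := by
    intro m k j
    rw [← integral_weightFactor hξ hV hβ, ← mul_assoc]
    exact hmodel.integral_nodes_weights hlam hmu ha ha' m k j hh
      (measurable_weightFactor _ _ _ _ _ _) (norm_weightFactor_le hα' hβ _ _ _ _)
  simp only [hterm] at hs
  rw [← hs.tsum_eq, hs.summable.tsum_prod, tsum_fintype, Finset.sum_range]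
  refine Finset.sum_congr rfl fun i _ => ?_
  have h1 := hasSum_integral_nodeProb hlam hmu ha ha' (M₁ + i) hh
  have h2 := hasSum_window (V := V) hlam hmu ha ha' hξ hα' hβ hh (M₁ + L) (M₁ + i + 1)
    (by have := i.2; omega)
  have h3 := h1.mul h2 (hs.summable.prod_factor i)
  rw [h3.tsum_eq, show M₁ + L - (M₁ + i + 1) = L - 1 - i by omega]
  ring

end IsExponentialModel

end Expectation

end NetworkAttack

/-- The joint transform at the first observed exit.  The exit indices are those of strict
exceedance, `μ₁ = inf {m : N_m > M₁}`, `μ = inf {m : N_m > M}`, `ν = inf {m : W_m > V}`; strict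
exceedance of the integers `M₁, M` means reaching the levels `M₁ + 1, M + 1`, at which the closed
form is taken. -/
theorem proposition5p7 {Ω : Type*} [MeasurableSpace Ω] (P : Measure Ω) [IsProbabilityMeasure P]
    (lam mu a ξ V : ℝ) (hlam : 0 < lam) (hmu : 0 < mu) (ha : 0 < a) (ha' : a ≤ 1) (hξ : 0 < ξ)
    (hV : 0 < V) (M₁ M : ℕ) (hM : M₁ + 1 < M)
    (t : ℕ → Ω → ℝ) (n : ℕ → Ω → ℕ) (w : ℕ → ℕ → Ω → ℝ) (Δ : ℕ → Ω → ℝ)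
    (hmodel : NetworkAttack.IsExponentialModel P lam mu a ξ t n w Δ)
    (α β h : ℂ) (hα : α ≠ 0) (hα' : ‖α‖ ≤ 1) (hβ : 0 ≤ β.re) (hh : 0 ≤ h.re) :
    Integrable (NetworkAttack.exitVariable t n w Δ M₁ M V α β h) P ∧
      ∫ ω, NetworkAttack.exitVariable t n w Δ M₁ M V α β h ω ∂P =
        NetworkAttack.closedForm lam mu a ξ V (M₁ + 1) (M + 1) α β h := by
  obtain ⟨L, rfl⟩ : ∃ L, M = M₁ + L := ⟨M - M₁, by omega⟩
  refine ⟨hmodel.integrable_exitVariable hlam hmu ha ha' hξ hα' hβ hh M₁ L, ?_⟩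
  rw [hmodel.integral_exitVariable hlam hmu ha ha' hξ hV hα' hβ hh M₁ L,
    NetworkAttack.closedForm_eq_sum lam mu a ξ V hlam hmu ha ha' hξ M₁ L (by omega) α β h hα hα'
      hβ hh]
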